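/- Put $h=1/\sqrt3$. Tile $\mathbb R^2$ by regular triangles of side $2$ (height $3h=\sqrt3$) as follows. Triangles of the first type (apex above the horizontal side) have the centres $(2n,\,h+6lh)$ and $(2n+1,\,-2h+6lh)$, and triangles of the second type (apex below the horizontal side) have the centres $(2n,\,-h+6lh)$ and $(2n+1,\,2h+6lh)$, with $n,l\in\mathbb Z$. A triangle of the first type contains its sides except for its two lower vertices, and a triangle of the second type is open; these triangles form a partition of the plane. Let $c(x)$ be the centre of the triangle that contains $x$, let $f(x)=c(x)+4\,(x-c(x))$, and let $\mathcal F\mu=\mu\circ f^{-1}$ be the Perron–Frobenius operator. Let $\mu_0$ be a probability measure on $\mathbb R^2$ with a density $\rho_0\ge 0$ that is constant on each triangle, and let $\mu_n=\mathcal F^n\mu_0$. Then: 1. For every $n$ the measure $\mu_n$ has a density $\rho_n\ge 0$ that is constant on each triangle. 2. The evolution is a $2\times2$ matrix convolution. For $i=1,2$ let $\mu_n^{(i)}=\sum_c \mu_n(\Omega_c)\,\delta_c$, where $c$ runs over the centres of the triangles $\Omega_c$ of type $i$. Then for all $n\ge0$ $$\mu_{n+1}^{(i)}=\sum_{j=1}^{2}E_{ij}*\mu_n^{(j)},\qquad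 i=1,2,$$ where, with $\delta_{(a,b)}$ the Dirac measure at $(a,b)$, $$E_{11}=\tfrac1{16}\Bigl(\sum_{a\in\{\pm1,\pm3\}}\delta_{(a,-3h)}+\sum_{a\in\{0,\pm2\}}\delta_{(a,0)}+\sum_{a\in\{\pm1\}}\delta_{(a,3h)}+\delta_{(0,6h)}\Bigr),$$ $$E_{21}=\tfrac1{16}\Bigl(\sum_{a\in\{0,\pm2\}}\delta_{(a,-2h)}+\sum_{a\in\{\pm1\}}\delta_{(a,h)}+\delta_{(0,4h)}\Bigr),$$ and $E_{22}$, $E_{12}$ are the images of $E_{11}$, $E_{21}$ under $(x_1,x_2)\mapsto(x_1,-x_2)$. 3. As $n\to\infty$ the density is asymptotically Gaussian, both uniformly at the scale $1/n$ and in $L^1$: $$\sup_{x\in\mathbb R^2}\; n\,\Bigl|\rho_n(x)-\frac1{5\pi n}e^{-|x|^2/(5n)}\Bigr|\to0,\qquad \int_{\mathbb R^2}\Bigl|\rho_n(x)-\frac1{5\pi n}e^{-|x|^2/(5n)}\Bigr|\,dx\to0.$$ 4. Normal deterministic diffusion occurs with diffusion coefficient $5/4$: $$\lim_{n\to\infty}\frac1{4n}\int_{\mathbb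 R^2}\bigl|f^n(x)-x\bigr|^2\,d\mu_0(x)=\frac54 .$$ -/

import Mathlib

open MeasureTheory Filter Topology
open scoped ENNReal

namespace TriangleTiling

/-- The Euclidean plane. -/
abbrev Plane : Type := EuclideanSpace ℝ (Fin 2)

/-- One third of the height `√3` of a regular triangle of side `2`. -/
noncomputable def h : ℝ := Real.sqrt 3 / 3

/-- The centres of the triangles of the tiling: index `0` is for the first type (apex above the
horizontal side), index `1` for the second type (apex below the horizontal side). -/
def centres : Fin 2 → Set Plane
  | 0 => {c | ∃ n l : ℤ, c = !₂[2 * (n : ℝ), h + 6 * l * h] ∨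
                         c = !₂[2 * (n : ℝ) + 1, -2 * h + 6 * l * h]}
  | 1 => {c | ∃ n l : ℤ, c = !₂[2 * (n : ℝ), -h + 6 * l * h] ∨
                         c = !₂[2 * (n : ℝ) + 1, 2 * h + 6 * l * h]}

/-- The triangle of the given type with centre `c`. A triangle of the first type contains its
sides, except for its two lower vertices; a triangle of the second type is open. -/
def triangle : Fin 2 → Plane → Set Plane
  | 0, c => convexHull ℝ {c + !₂[0, 2 * h], c + !₂[-1, -h], c + !₂[1, -h]} \
              {c + !₂[-1, -h], c + !₂[1, -h]}
  | 1, c => interior (convexHull ℝ {c + !₂[0, -2 * h], c + !₂[-1, h], c + !₂[1, h]})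

theorem h_pos : 0 < h := by unfold h; positivity

theorem three_h_sq : 3 * (h * h) = 1 := by
  have := Real.mul_self_sqrt (show (0 : ℝ) ≤ 3 by norm_num)
  unfold h
  nlinarith

/-- The closed triangle with apex above (`s = 1`) or below (`s = -1`), by inequalities. -/
theorem mem_hull (s : ℝ) (hs : s = 1 ∨ s = -1) (c x : Plane) :
    x ∈ convexHull ℝ {c + !₂[0, s * (2 * h)], c + !₂[-1, s * -h], c + !₂[1, s * -h]} ↔
      -h ≤ s * (x 1 - c 1) ∧ 3 * h * (x 0 - c 0) + s * (x 1 - c 1) ≤ 2 * h ∧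
        -(3 * h * (x 0 - c 0)) + s * (x 1 - c 1) ≤ 2 * h := by
  have hp := h_pos
  have h3 := three_h_sq
  have hss : s * s = 1 := by rcases hs with rfl | rfl <;> norm_num
  constructor
  · intro hx
    let S : Set Plane := {x | -h ≤ s * (x 1 - c 1) ∧
      3 * h * (x 0 - c 0) + s * (x 1 - c 1) ≤ 2 * h ∧
        -(3 * h * (x 0 - c 0)) + s * (x 1 - c 1) ≤ 2 * h}
    have hS : Convex ℝ S := by
      intro y hy z hz a b ha hb hab
      obtain ⟨h1, h2, h3⟩ := hy
      obtain ⟨k1, k2, k3⟩ := hz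
      obtain rfl : b = 1 - a := by linarith
      refine ⟨?_, ?_, ?_⟩ <;> simp only [PiLp.add_apply, PiLp.smul_apply, smul_eq_mul]
      · nlinarith [mul_le_mul_of_nonneg_left h1 ha, mul_le_mul_of_nonneg_left k1 hb]
      · nlinarith [mul_le_mul_of_nonneg_left h2 ha, mul_le_mul_of_nonneg_left k2 hb]
      · nlinarith [mul_le_mul_of_nonneg_left h3 ha, mul_le_mul_of_nonneg_left k3 hb]
    refine convexHull_min ?_ hS hx
    intro y hy
    rcases hy with rfl | rfl | rfl <;> refine ⟨?_, ?_, ?_⟩ <;> simp <;> nlinarith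
  · rintro ⟨h1, h2, h3'⟩
    set u := x 0 - c 0 with hu
    set v := s * (x 1 - c 1) with hv
    have hv' : x 1 - c 1 = s * v := by rw [hv, ← mul_assoc, hss, one_mul]
    have hC := convex_convexHull ℝ
      ({c + !₂[0, s * (2 * h)], c + !₂[-1, s * -h], c + !₂[1, s * -h]} : Set Plane)
    have key := hC.sum_mem (t := Finset.univ)
      (w := ![(v + h) * h, (2 * h - v - 3 * h * u) * h / 2, (2 * h - v + 3 * h * u) * h / 2])
      (z := ![c + !₂[0, s * (2 * h)], c + !₂[-1, s * -h], c + !₂[1, s * -h]])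
      (by
        intro i _
        fin_cases i <;> simp
        · exact mul_nonneg (by linarith) hp.le
        · have := mul_nonneg (show 0 ≤ 2 * h - v - 3 * h * u by linarith) hp.le
          linarith
        · have := mul_nonneg (show 0 ≤ 2 * h - v + 3 * h * u by linarith) hp.le
          linarith)
      (by simp [Fin.sum_univ_three]; linear_combination h3)
      (by
        intro i _
        apply subset_convexHull
        fin_cases i <;> simp)
    convert key using 1
    ext i
    fin_cases i
    · simp [Fin.sum_univ_three]
      linear_combination (-c 0 - u) * h3 + hu
    · simp [Fin.sum_univ_three]
      linear_combination (-c 1 - s * v) * h3 + hv'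

theorem mem_triangle_zero (c x : Plane) :
    x ∈ triangle 0 c ↔ -h ≤ x 1 - c 1 ∧ 3 * h * (x 0 - c 0) + (x 1 - c 1) ≤ 2 * h ∧
        -(3 * h * (x 0 - c 0)) + (x 1 - c 1) ≤ 2 * h ∧
        ¬ (x 1 - c 1 = -h ∧ (x 0 - c 0 = 1 ∨ x 0 - c 0 = -1)) := by
  have := mem_hull 1 (Or.inl rfl) c x
  simp only [one_mul] at this
  simp only [triangle, Set.mem_sdiff, this, Set.mem_insert_iff, Set.mem_singleton_iff]
  have e : ∀ a : ℝ, x = c + !₂[a, -h] ↔ x 0 - c 0 = a ∧ x 1 - c 1 = -h := by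
    intro a
    constructor
    · rintro rfl; simp
    · rintro ⟨h1, h2⟩
      ext i
      fin_cases i
      · simp; linarith
      · simp; linarith
  rw [e, e]
  tauto

theorem interior_halfPlane (g : Plane →L[ℝ] ℝ) (y : Plane) (hy : g y ≠ 0) (a : ℝ) :
    interior {x | g x ≤ a} = {x | g x < a} := by
  have hsurj : Function.Surjective g := fun t => ⟨(t / g y) • y, by simp [hy]⟩
  have := (g.isOpenMap hsurj).preimage_interior_eq_interior_preimage g.continuous (Set.Iic a)
  rw [interior_Iic] at this
  exact this.symm

theorem mem_triangle_one (c x : Plane) :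
    x ∈ triangle 1 c ↔ x 1 - c 1 < h ∧ 3 * h * (x 0 - c 0) - (x 1 - c 1) < 2 * h ∧
        -(3 * h * (x 0 - c 0)) - (x 1 - c 1) < 2 * h := by
  let p0 : Plane →L[ℝ] ℝ := EuclideanSpace.proj 0
  let p1 : Plane →L[ℝ] ℝ := EuclideanSpace.proj 1
  have e0 : ∀ x, p0 x = x 0 := fun _ => rfl
  have e1 : ∀ x, p1 x = x 1 := fun _ => rfl
  have hset : convexHull ℝ {c + !₂[0, -2 * h], c + !₂[-1, h], c + !₂[1, h]} =
      {x | p1 x ≤ c 1 + h} ∩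
      ({x | ((3 * h) • p0 - p1) x ≤ 2 * h + (3 * h * c 0 - c 1)} ∩
        {x | (-(3 * h) • p0 - p1) x ≤ 2 * h + (-(3 * h * c 0) - c 1)}) := by
    ext x
    have := mem_hull (-1) (Or.inr rfl) c x
    simp only [neg_one_mul, neg_neg, ← neg_mul] at this
    rw [this]
    simp only [Set.mem_inter_iff, Set.mem_ofPred_eq, sub_apply,
      smul_apply, smul_eq_mul, e0, e1]
    refine and_congr ?_ (and_congr ?_ ?_) <;> constructor <;> intro h <;> linarith
  have hy0 : (!₂[0, 1] : Plane) 0 = 0 := rfl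
  have hy1 : (!₂[0, 1] : Plane) 1 = 1 := rfl
  rw [triangle, hset, interior_inter, interior_inter,
    interior_halfPlane p1 !₂[0, 1] (by rw [e1, hy1]; norm_num),
    interior_halfPlane _ !₂[0, 1] (by
      simp only [sub_apply, smul_apply, smul_eq_mul,
        e0, e1, hy0, hy1]; norm_num),
    interior_halfPlane _ !₂[0, 1] (by
      simp only [sub_apply, smul_apply, smul_eq_mul,
        e0, e1, hy0, hy1]; norm_num)]
  simp only [Set.mem_inter_iff, Set.mem_ofPred_eq, sub_apply,
      smul_apply, smul_eq_mul, e0, e1]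
  refine and_congr ?_ (and_congr ?_ ?_) <;> constructor <;> intro h <;> linarith

/-- The triangles form a partition of the plane. -/
theorem existsUnique_triangle (x : Plane) :
    ∃! p : Fin 2 × Plane, p.2 ∈ centres p.1 ∧ x ∈ triangle p.1 p.2 := by
  have hp := h_pos
  have h3 := three_h_sq
  -- scaled second coordinate
  obtain ⟨u, hu⟩ : ∃ u : ℝ, x 1 = 3 * h * u := ⟨x 1 / (3 * h), by field_simp⟩
  -- membership in the row-and-column description
  have c0 : ∀ c : Plane, c ∈ centres 0 ↔
      ∃ m k j : ℤ, m = k + 2 * j ∧ c 0 = m ∧ c 1 = h + 3 * h * k := by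
    intro c
    constructor
    · rintro ⟨n, l, rfl | rfl⟩
      · exact ⟨2 * n, 2 * l, n - l, by ring, by simp, by simp; ring⟩
      · exact ⟨2 * n + 1, 2 * l - 1, n - l + 1, by ring, by simp, by simp; ring⟩
    · rintro ⟨m, k, j, hm, hc0, hc1⟩
      rcases Int.even_or_odd' k with ⟨l, hl | hl⟩
      · refine ⟨l + j, l, Or.inl ?_⟩
        subst hl hm
        ext i
        fin_cases i
        · simp [hc0]; ring
        · simp [hc1]; ring
      · refine ⟨l + j, l + 1, Or.inr ?_⟩
        subst hl hm
        ext i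
        fin_cases i
        · simp [hc0]; ring
        · simp [hc1]; ring
  have c1 : ∀ c : Plane, c ∈ centres 1 ↔
      ∃ m k j : ℤ, m = k + 2 * j + 1 ∧ c 0 = m ∧ c 1 = 2 * h + 3 * h * k := by
    intro c
    constructor
    · rintro ⟨n, l, rfl | rfl⟩
      · exact ⟨2 * n, 2 * l - 1, n - l, by ring, by simp, by simp; ring⟩
      · exact ⟨2 * n + 1, 2 * l, n - l, by ring, by simp, by simp; ring⟩
    · rintro ⟨m, k, j, hm, hc0, hc1⟩
      rcases Int.even_or_odd' k with ⟨l, hl | hl⟩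
      · refine ⟨l + j, l, Or.inr ?_⟩
        subst hl hm
        ext i
        fin_cases i
        · simp [hc0]; ring
        · simp [hc1]; ring
      · refine ⟨l + j + 1, l + 1, Or.inl ?_⟩
        subst hl hm
        ext i
        fin_cases i
        · simp [hc0]; ring
        · simp [hc1]; ring
  have t0 : ∀ (c : Plane) (m k : ℤ), c 0 = m → c 1 = h + 3 * h * k → (x ∈ triangle 0 c ↔
      k ≤ u ∧ x 0 - m + (u - k) ≤ 1 ∧ -(x 0 - m) + (u - k) ≤ 1 ∧
        ¬ (u = k ∧ (x 0 - m = 1 ∨ x 0 - m = -1))) := by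
    intro c m k hm hk
    rw [mem_triangle_zero, hm, hk, hu]
    have hh : 0 < 3 * h := by linarith
    have a1 : -h ≤ 3 * h * u - (h + 3 * h * k) ↔ (k : ℝ) ≤ u := by
      constructor <;> intro q <;> nlinarith
    have a2 : 3 * h * (x 0 - m) + (3 * h * u - (h + 3 * h * k)) ≤ 2 * h ↔
        x 0 - m + (u - k) ≤ 1 := by
      constructor <;> intro q <;> nlinarith
    have a3 : -(3 * h * (x 0 - m)) + (3 * h * u - (h + 3 * h * k)) ≤ 2 * h ↔
        -(x 0 - m) + (u - k) ≤ 1 := by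
      constructor <;> intro q <;> nlinarith
    have a4 : 3 * h * u - (h + 3 * h * k) = -h ↔ u = k := by
      constructor
      · intro q
        exact mul_left_cancel₀ hh.ne' (by linarith)
      · rintro rfl
        ring
    rw [a1, a2, a3, a4]
  have t1 : ∀ (c : Plane) (m k : ℤ), c 0 = m → c 1 = 2 * h + 3 * h * k → (x ∈ triangle 1 c ↔
      u < k + 1 ∧ x 0 - m < u - k ∧ -(x 0 - m) < u - k) := by
    intro c m k hm hk
    rw [mem_triangle_one, hm, hk, hu]
    have hh : 0 < 3 * h := by linarith
    have a1 : 3 * h * u - (2 * h + 3 * h * k) < h ↔ u < (k : ℝ) + 1 := by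
      constructor <;> intro q <;> nlinarith
    have a2 : 3 * h * (x 0 - m) - (3 * h * u - (2 * h + 3 * h * k)) < 2 * h ↔
        x 0 - m < u - k := by
      constructor <;> intro q <;> nlinarith
    have a3 : -(3 * h * (x 0 - m)) - (3 * h * u - (2 * h + 3 * h * k)) < 2 * h ↔
        -(x 0 - m) < u - k := by
      constructor <;> intro q <;> nlinarith
    rw [a1, a2, a3]
  have mk0 : ∀ m k j : ℤ, m = k + 2 * j → k ≤ u → x 0 - m + (u - k) ≤ 1 →
      -(x 0 - m) + (u - k) ≤ 1 → ¬ (u = k ∧ (x 0 - m = 1 ∨ x 0 - m = -1)) →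
      ∃ p : Fin 2 × Plane, p.2 ∈ centres p.1 ∧ x ∈ triangle p.1 p.2 := fun m k j hm a1 a2 a3 a4 =>
    ⟨(0, !₂[(m : ℝ), h + 3 * h * k]), (c0 _).2 ⟨m, k, j, hm, rfl, rfl⟩,
      (t0 _ m k rfl rfl).2 ⟨a1, a2, a3, a4⟩⟩
  have mk1 : ∀ m k j : ℤ, m = k + 2 * j + 1 → u < k + 1 → x 0 - m < u - k → -(x 0 - m) < u - k →
      ∃ p : Fin 2 × Plane, p.2 ∈ centres p.1 ∧ x ∈ triangle p.1 p.2 := fun m k j hm a1 a2 a3 =>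
    ⟨(1, !₂[(m : ℝ), 2 * h + 3 * h * k]), (c1 _).2 ⟨m, k, j, hm, rfl, rfl⟩,
      (t1 _ m k rfl rfl).2 ⟨a1, a2, a3⟩⟩
  refine existsUnique_of_exists_of_unique ?_ ?_
  · obtain ⟨k, hk⟩ : ∃ k : ℤ, k = ⌊u⌋ := ⟨_, rfl⟩
    have k1 : (k : ℝ) ≤ u := hk ▸ Int.floor_le u
    have k2 : u < k + 1 := hk ▸ Int.lt_floor_add_one u
    obtain ⟨j, hj⟩ : ∃ j : ℤ, j = ⌊(x 0 - k + 1) / 2⌋ := ⟨_, rfl⟩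
    have j1 : (j : ℝ) ≤ (x 0 - k + 1) / 2 := hj ▸ Int.floor_le _
    have j2 : (x 0 - k + 1) / 2 < j + 1 := hj ▸ Int.lt_floor_add_one _
    -- the nearest admissible column
    have hm : ((k + 2 * j : ℤ) : ℝ) = k + 2 * j := by push_cast; ring
    by_cases hv : u = k ∧ x 0 - (k + 2 * j) = -1
    · refine mk0 (k + 2 * j - 1) (k - 1) j (by ring) ?_ ?_ ?_ ?_ <;> push_cast
      · linarith
      · linarith [hv.1, hv.2]
      · linarith [hv.1, hv.2]
      · rintro ⟨q, -⟩
        linarith [hv.1]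
    by_cases r : x 0 - (k + 2 * j) + (u - k) ≤ 1
    · by_cases l : -(x 0 - (k + 2 * j)) + (u - k) ≤ 1
      · refine mk0 (k + 2 * j) k j rfl k1 (by rw [hm]; exact r) (by rw [hm]; exact l) ?_
        rw [hm]
        rintro ⟨q, q' | q'⟩
        · linarith
        · exact hv ⟨q, q'⟩
      · push Not at l
        refine mk1 (k + 2 * j - 1) k (j - 1) (by ring) k2 ?_ ?_ <;> push_cast <;> linarith
    · push Not at r
      refine mk1 (k + 2 * j + 1) k j rfl k2 ?_ ?_ <;> push_cast <;> linarith
  · rintro ⟨i, c⟩ ⟨i', c'⟩ ⟨hc, hx⟩ ⟨hc', hx'⟩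
    have castle : ∀ a b : ℤ, (a : ℝ) < b + 1 → a ≤ b := fun a b hab => by
      have : a < b + 1 := by exact_mod_cast hab
      omega
    have mixed : ∀ c c' : Plane, c ∈ centres 0 → c' ∈ centres 1 → x ∈ triangle 0 c →
        x ∈ triangle 1 c' → False := by
      intro c c' hc hc' hx hx'
      obtain ⟨m, k, j, e, e0, e1⟩ := (c0 _).1 hc
      obtain ⟨m', k', j', e', e0', e1'⟩ := (c1 _).1 hc'
      obtain ⟨a1, a2, a3, -⟩ := (t0 _ _ _ e0 e1).1 hx
      obtain ⟨b1, b2, b3⟩ := (t1 _ _ _ e0' e1').1 hx'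
      have q1 := castle k k' (by linarith)
      have q2 := castle k' k (by linarith)
      obtain rfl : k = k' := by omega
      have q3 := castle m m' (by linarith)
      have q4 := castle m' m (by linarith)
      omega
    have fin : ∀ m k m' k' : ℤ, m = m' → k = k' → ∀ d : ℝ, c 0 = m → c 1 = d + 3 * h * k →
        c' 0 = m' → c' 1 = d + 3 * h * k' → c = c' := by
      rintro m k _ _ rfl rfl d e0 e1 e0' e1'
      ext i
      fin_cases i
      · exact e0.trans e0'.symm
      · exact e1.trans e1'.symm
    fin_cases i <;> fin_cases i'
    · obtain ⟨m, k, j, e, e0, e1⟩ := (c0 _).1 hc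
      obtain ⟨m', k', j', e', e0', e1'⟩ := (c0 _).1 hc'
      obtain ⟨a1, a2, a3, a4⟩ := (t0 _ _ _ e0 e1).1 hx
      obtain ⟨b1, b2, b3, b4⟩ := (t0 _ _ _ e0' e1').1 hx'
      have apex : ∀ m k m' k' j j' : ℤ, m = k + 2 * j → m' = k' + 2 * j' → k ≤ u →
          x 0 - m + (u - k) ≤ 1 → -(x 0 - m) + (u - k) ≤ 1 → k' ≤ u → x 0 - m' + (u - k') ≤ 1 →
          -(x 0 - m') + (u - k') ≤ 1 → ¬ (u = k' ∧ (x 0 - m' = 1 ∨ x 0 - m' = -1)) →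
          k' ≤ k := by
        intro m k m' k' j j' e e' a1 a2 a3 b1 b2 b3 b4
        by_contra q
        have q' : k + 1 ≤ k' := by omega
        have q'' : (k : ℝ) + 1 ≤ k' := by exact_mod_cast q'
        have u1 : u = k + 1 := by linarith
        have u2 : (k' : ℝ) = k + 1 := by linarith
        have u3 : k' = k + 1 := by exact_mod_cast u2
        have x1 : x 0 = m := by linarith
        have l1 : m ≤ m' + 1 := by
          have : (m : ℝ) ≤ m' + 1 := by linarith
          exact_mod_cast this
        have l2 : m' ≤ m + 1 := by
          have : (m' : ℝ) ≤ m + 1 := by linarith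
          exact_mod_cast this
        have l3 : m = m' + 1 ∨ m' = m + 1 := by omega
        apply b4
        refine ⟨by linarith, ?_⟩
        rcases l3 with l3 | l3
        · left
          rw [x1, l3]; push_cast; ring
        · right
          rw [x1, l3]; push_cast; ring
      have s1 := apex m k m' k' j j' e e' a1 a2 a3 b1 b2 b3 b4
      have s2 := apex m' k' m k j' j e' e b1 b2 b3 a1 a2 a3 a4
      obtain rfl : k = k' := by omega
      have base : ∀ m m' j j' : ℤ, m = k + 2 * j → m' = k + 2 * j' → x 0 - m + (u - k) ≤ 1 →
          -(x 0 - m') + (u - k) ≤ 1 → ¬ (u = k ∧ (x 0 - m = 1 ∨ x 0 - m = -1)) →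
          m' ≤ m := by
        intro m m' j j' e e' a2 b3 a4
        by_contra q
        have q' : m + 2 ≤ m' := by omega
        have q'' : (m : ℝ) + 2 ≤ m' := by exact_mod_cast q'
        exact a4 ⟨by linarith, Or.inl (by linarith)⟩
      have s3 := base m m' j j' e e' a2 b3 a4
      have s4 := base m' m j' j e' e b2 a3 b4
      exact Prod.ext rfl (fin m k m' k (by omega) rfl h e0 e1 e0' e1')
    · exact (mixed _ _ hc hc' hx hx').elim
    · exact (mixed _ _ hc' hc hx' hx).elim
    · obtain ⟨m, k, j, e, e0, e1⟩ := (c1 _).1 hc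
      obtain ⟨m', k', j', e', e0', e1'⟩ := (c1 _).1 hc'
      obtain ⟨a1, a2, a3⟩ := (t1 _ _ _ e0 e1).1 hx
      obtain ⟨b1, b2, b3⟩ := (t1 _ _ _ e0' e1').1 hx'
      have q1 := castle k k' (by linarith)
      have q2 := castle k' k (by linarith)
      obtain rfl : k = k' := by omega
      have q3 := castle m (m' + 1) (by push_cast; linarith)
      have q4 := castle m' (m + 1) (by push_cast; linarith)
      exact Prod.ext rfl (fin m k m' k (by omega) rfl (2 * h) e0 e1 e0' e1')

/-- The centre `c(x)` of the triangle of the tiling to which `x` belongs. -/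
noncomputable def centre (x : Plane) : Plane := (existsUnique_triangle x).choose.2

theorem centre_eq {i : Fin 2} {c x : Plane} (hc : c ∈ centres i) (hx : x ∈ triangle i c) :
    centre x = c :=
  (congrArg Prod.snd ((existsUnique_triangle x).choose_spec.2 (i, c) ⟨hc, hx⟩)).symm

/-- The dynamical system: each triangle is stretched `Λ` times from its centre. -/
noncomputable def stretch (Λ : ℝ) (x : Plane) : Plane := centre x + Λ • (x - centre x)

/-- The Perron-Frobenius operator on measures, `A ↦ μ (f⁻¹ A)`. -/
noncomputable def perronFrobenius (f : Plane → Plane) (μ : Measure Plane) : Measure Plane :=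
  μ.map f

/-- `μ` is uniform on each triangle, with density `ρ` (a function constant on each triangle). -/
structure HasTriangleDensity (μ : Measure Plane) (ρ : Plane → ℝ) : Prop where
  nonneg : ∀ x, 0 ≤ ρ x
  const : ∀ i, ∀ c ∈ centres i, ∀ x ∈ triangle i c, ∀ y ∈ triangle i c, ρ x = ρ y
  eq_withDensity : μ = volume.withDensity fun x => ENNReal.ofReal (ρ x)

/-- The union of the triangles of the given type. -/
def region (i : Fin 2) : Set Plane := ⋃ c ∈ centres i, triangle i c

/-- The part of `μ` in the triangles of type `i`, recorded at the centres of these triangles: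
the sum of `μ (triangle i c) δ_c` over the centres `c` of type `i`. -/
noncomputable def atCentres (μ : Measure Plane) (i : Fin 2) : Measure Plane :=
  (μ.restrict (region i)).map centre

/-- The Dirac measure at `(a, b * h)`. -/
noncomputable def δ (a b : ℝ) : Measure Plane := Measure.dirac !₂[a, b * h]

/-- For `s = 1`: transfer from the first type to the first type. For `s = -1` its mirror image in
the horizontal axis. -/
noncomputable def kernelSame (s : ℝ) : Measure Plane :=
  (1 / 16 : ℝ≥0∞) •
    ((δ (-3) (s * -3) + δ (-1) (s * -3) + δ 1 (s * -3) + δ 3 (s * -3))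
      + (δ (-2) 0 + δ 0 0 + δ 2 0)
      + (δ (-1) (s * 3) + δ 1 (s * 3))
      + δ 0 (s * 6))

/-- For `s = 1`: transfer from the first type to the second type. For `s = -1` its mirror image in
the horizontal axis. -/
noncomputable def kernelOther (s : ℝ) : Measure Plane :=
  (1 / 16 : ℝ≥0∞) •
    ((δ (-2) (s * -2) + δ 0 (s * -2) + δ 2 (s * -2))
      + (δ (-1) (s * 1) + δ 1 (s * 1))
      + δ 0 (s * 4))

/-- The matrix of the evolution for `Λ = 4`; the entry `E i j` describes the transfer from
triangles of type `j` to triangles of type `i`. -/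
noncomputable def E : Matrix (Fin 2) (Fin 2) (Measure Plane) :=
  !![kernelSame 1, kernelOther (-1);
     kernelOther 1, kernelSame (-1)]

end TriangleTiling

open TriangleTiling

/-! In the affine coordinates s = `coordS`, t = `coordT` the sides of the tiles lie on the lines
where s, t or s + t is an integer, and each unit square of the (s, t)-lattice consists of one tile
of each type. The centres sit at lattice points shifted by (1/3, 1/3) or (2/3, 2/3). Since 4 ≡ 1 mod
3, stretching a tile 4 times from its centre sends its sides to lines of the same grid, so its image
is, up to a null set, a union of 16 tiles: 10 of its own type and 6 of the other (`image_tile_ae`).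
The map f therefore acts on measures uniform on each tile as a random walk on tiles with sixteen
equally likely jumps (`map_stretch_tileMeasure`). This yields the persistence of tile-wise constant
densities and the matrix convolution.

Diffusion coefficient: the sixteen jumps have mean zero and mean square length 5, whatever the type
of the starting tile, so the mean square displacement of the centres after n steps is exactly 5n.
Replacing points by centres changes displacements by a bounded amount, which is negligible after
division by n.

Gaussian limit: the Fourier transform turns the walk into iteration of the 2 × 2 matrix with rows
(a, b̄) and (b, ā). The conjugates come from the point symmetry that exchanges the two types. For
the sum S and the difference D of the two components this reads S' = Re(a+b) S + i Im(a+b) D and D'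
= Re(a-b) D + i Im(a-b) S. At frequency τ/√n one has n(a+b-1) → -`quad τ`, which is real, while a-b
→ 1/4. Hence S converges to exp(-`quad τ`) and D dies out, so each type carries half of the Gaussian
(`tendsto_fourier`). The bound (|a|+|b|)ⁿ gives a Gaussian majorant on the dual fundamental domain.
Fourier inversion and dominated convergence then give a local limit theorem uniform over the tiles
(`tendstoUniformly_weights`). Moving from centres to points costs O(1/√n) in the rescaled density.
Convergence in L¹ follows by a Scheffé argument from equality of total masses. -/

namespace TriangleTiling

/-! ### Tiles indexed by type and lattice point -/

/-- The tiles: a type and the lattice coordinates of the centre. -/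
abbrev Tile : Type := Fin 2 × ℤ × ℤ

/-- The centre of a tile. -/
noncomputable def tileCentre : Tile → Plane
  | (0, k, j) => !₂[(k : ℝ) + 2 * j, h + 3 * h * k]
  | (1, k, j) => !₂[(k : ℝ) + 2 * j + 1, 2 * h + 3 * h * k]

/-- The set of points of a tile. -/
noncomputable def tileSet (a : Tile) : Set Plane := triangle a.1 (tileCentre a)

theorem tileCentre_mem_centres (a : Tile) : tileCentre a ∈ centres a.1 := by
  obtain ⟨i, k, j⟩ := a
  fin_cases i
  · rcases Int.even_or_odd' k with ⟨l, rfl | rfl⟩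
    · refine ⟨l + j, l, Or.inl ?_⟩
      ext i; fin_cases i <;> simp [tileCentre] <;> ring
    · refine ⟨l + j, l + 1, Or.inr ?_⟩
      ext i; fin_cases i <;> simp [tileCentre] <;> ring
  · rcases Int.even_or_odd' k with ⟨l, rfl | rfl⟩
    · refine ⟨l + j, l, Or.inr ?_⟩
      ext i; fin_cases i <;> simp [tileCentre] <;> ring
    · refine ⟨l + j + 1, l + 1, Or.inl ?_⟩
      ext i; fin_cases i <;> simp [tileCentre] <;> ring

theorem exists_tileCentre_eq {i : Fin 2} {c : Plane} (hc : c ∈ centres i) :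
    ∃ z : ℤ × ℤ, tileCentre (i, z) = c := by
  fin_cases i
  · obtain ⟨n, l, rfl | rfl⟩ := hc
    · refine ⟨(2 * l, n - l), ?_⟩
      ext i; fin_cases i <;> simp [tileCentre] <;> ring
    · refine ⟨(2 * l - 1, n - l + 1), ?_⟩
      ext i; fin_cases i <;> simp [tileCentre] <;> ring
  · obtain ⟨n, l, rfl | rfl⟩ := hc
    · refine ⟨(2 * l - 1, n - l), ?_⟩
      ext i; fin_cases i <;> simp [tileCentre] <;> ring
    · refine ⟨(2 * l, n - l), ?_⟩
      ext i; fin_cases i <;> simp [tileCentre] <;> ring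

theorem tileCentre_injective (i : Fin 2) : Function.Injective fun z => tileCentre (i, z) := by
  rintro ⟨k, j⟩ ⟨k', j'⟩ hz
  have hp := h_pos
  have e0 := congrArg (fun x : Plane => x 0) hz
  have e1 := congrArg (fun x : Plane => x 1) hz
  have hk : k = k' := by
    have : (k : ℝ) = k' := by
      fin_cases i <;> simp [tileCentre] at e1 <;>
        rcases e1 with e1 | e1 <;> first | exact_mod_cast e1 | exact absurd e1 hp.ne'
    exact_mod_cast this
  subst hk
  have : (j : ℝ) = j' := by fin_cases i <;> simpa [tileCentre] using e0
  simpa using this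

theorem exists_mem_tileSet (x : Plane) : ∃ a, x ∈ tileSet a := by
  obtain ⟨⟨i, c⟩, ⟨hc, hx⟩, -⟩ := existsUnique_triangle x
  obtain ⟨z, hz⟩ := exists_tileCentre_eq hc
  exact ⟨(i, z), by rw [tileSet, hz]; exact hx⟩

/-- The tile to which a point belongs. -/
noncomputable def tile (x : Plane) : Tile := (exists_mem_tileSet x).choose

theorem mem_tileSet_tile (x : Plane) : x ∈ tileSet (tile x) := (exists_mem_tileSet x).choose_spec

theorem eq_of_mem_tileSet {a b : Tile} {x : Plane} (ha : x ∈ tileSet a) (hb : x ∈ tileSet b) :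
    a = b := by
  have := (existsUnique_triangle x).unique (y₁ := (a.1, tileCentre a)) (y₂ := (b.1, tileCentre b))
    ⟨tileCentre_mem_centres a, ha⟩ ⟨tileCentre_mem_centres b, hb⟩
  obtain ⟨i, z⟩ := a
  obtain ⟨i', z'⟩ := b
  obtain ⟨rfl, h2⟩ := Prod.ext_iff.1 this
  exact Prod.ext rfl (tileCentre_injective i h2)

theorem mem_tileSet_iff {a : Tile} {x : Plane} : x ∈ tileSet a ↔ tile x = a :=
  ⟨fun hx => eq_of_mem_tileSet (mem_tileSet_tile x) hx, fun hx => hx ▸ mem_tileSet_tile x⟩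

theorem centre_eq_tileCentre (x : Plane) : centre x = tileCentre (tile x) :=
  centre_eq (tileCentre_mem_centres _) (mem_tileSet_tile x)

theorem pairwise_disjoint_tileSet : Pairwise (Function.onFun Disjoint tileSet) := by
  intro a b hab
  exact Set.disjoint_left.2 fun x ha hb => hab (eq_of_mem_tileSet ha hb)

theorem iUnion_tileSet : ⋃ a, tileSet a = Set.univ :=
  Set.eq_univ_of_forall fun x => Set.mem_iUnion.2 (exists_mem_tileSet x)

theorem measurableSet_tileSet (a : Tile) : MeasurableSet (tileSet a) := by
  obtain ⟨i, z⟩ := a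
  have m0 : Measurable fun x : Plane => x 0 := by fun_prop
  have m1 : Measurable fun x : Plane => x 1 := by fun_prop
  fin_cases i
  · have : tileSet (0, z) = {x : Plane | _} := Set.ext fun x => mem_triangle_zero (tileCentre (0, z)) x
    rw [show ((⟨0, by decide⟩ : Fin 2), z) = ((0 : Fin 2), z) from rfl, this]
    measurability
  · exact isOpen_interior.measurableSet

/-- With the discrete structure every function of the tile is measurable, and countability of the
tiles makes `tile` itself measurable. -/
instance : MeasurableSpace Tile := ⊤

theorem measurable_tile : Measurable tile := by
  refine measurable_to_countable' fun a => ?_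
  convert measurableSet_tileSet a using 1
  ext x
  exact mem_tileSet_iff.symm

theorem measurable_centre : Measurable centre := by
  have : centre = tileCentre ∘ tile := funext centre_eq_tileCentre
  rw [this]
  exact (measurable_from_top).comp measurable_tile

theorem measurable_stretch (Λ : ℝ) : Measurable (stretch Λ) := by
  have := measurable_centre
  unfold stretch
  fun_prop

/-! ### Lattice coordinates, in which tiles are half unit squares -/

/-- The first lattice coordinate of a point. -/
noncomputable def coordS (x : Plane) : ℝ := x 1 / (3 * h)

/-- The second lattice coordinate of a point. -/
noncomputable def coordT (x : Plane) : ℝ := (x 0 - x 1 / (3 * h) + 1) / 2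

theorem apply_one_eq (x : Plane) : x 1 = 3 * h * coordS x := by
  have := h_pos
  unfold coordS; field_simp

theorem apply_zero_eq (x : Plane) : x 0 = coordS x + 2 * coordT x - 1 := by
  unfold coordS coordT; ring

/-- Tiles of the first type contain most of their boundary; excluding the three side lines makes the
description strict, as it already is for the open second type. -/
theorem mem_tileSet_zero {x : Plane} {k j : ℤ} (h1 : coordS x ≠ k) (h2 : coordT x ≠ j)
    (h3 : coordS x + coordT x ≠ k + j + 1) :
    x ∈ tileSet (0, k, j) ↔ k < coordS x ∧ j < coordT x ∧ coordS x + coordT x < k + j + 1 := by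
  have hp : 0 < 3 * h := by linarith [h_pos]
  rw [tileSet, mem_triangle_zero]
  simp only [tileCentre, apply_one_eq x, apply_zero_eq x]
  generalize coordS x = s at *
  generalize coordT x = t at *
  simp only [Fin.isValue, Matrix.cons_val_zero, Matrix.cons_val_one]
  have a1 : -h ≤ 3 * h * s - (h + 3 * h * k) ↔ (k : ℝ) ≤ s := by
    constructor <;> intro q <;> nlinarith
  have a2 : 3 * h * (s + 2 * t - 1 - (k + 2 * j)) + (3 * h * s - (h + 3 * h * k)) ≤ 2 * h ↔
      s + t ≤ k + j + 1 := by
    constructor <;> intro q <;> nlinarith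
  have a3 : -(3 * h * (s + 2 * t - 1 - (k + 2 * j))) + (3 * h * s - (h + 3 * h * k)) ≤ 2 * h ↔
      j ≤ t := by
    constructor <;> intro q <;> nlinarith
  have a4 : 3 * h * s - (h + 3 * h * k) = -h ↔ s = k := by
    constructor
    · intro q
      exact mul_left_cancel₀ hp.ne' (by linarith)
    · rintro rfl
      ring
  rw [a1, a2, a3, a4, h1.symm.le_iff_lt, h2.symm.le_iff_lt, h3.le_iff_lt]
  tauto

theorem mem_tileSet_one {x : Plane} {k j : ℤ} :
    x ∈ tileSet (1, k, j) ↔ coordS x < k + 1 ∧ coordT x < j + 1 ∧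
      k + j + 1 < coordS x + coordT x := by
  have hp : 0 < 3 * h := by linarith [h_pos]
  rw [tileSet, mem_triangle_one]
  simp only [tileCentre, apply_one_eq x, apply_zero_eq x]
  generalize coordS x = s at *
  generalize coordT x = t at *
  simp only [Fin.isValue, Matrix.cons_val_zero, Matrix.cons_val_one]
  have a1 : 3 * h * s - (2 * h + 3 * h * k) < h ↔ s < (k : ℝ) + 1 := by
    constructor <;> intro q <;> nlinarith
  have a2 : 3 * h * (s + 2 * t - 1 - (k + 2 * j + 1)) - (3 * h * s - (2 * h + 3 * h * k)) < 2 * h ↔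
      t < j + 1 := by
    constructor <;> intro q <;> nlinarith
  have a3 : -(3 * h * (s + 2 * t - 1 - (k + 2 * j + 1))) - (3 * h * s - (2 * h + 3 * h * k)) < 2 * h
      ↔ k + j + 1 < s + t := by
    constructor <;> intro q <;> nlinarith
  rw [a1, a2, a3]

/-! ### The image of a tile under stretching -/

/-- `offsets i j` lists the lattice displacements from a tile of type `j` to the tiles of type `i`
in its image. -/
def offsets : Fin 2 → Fin 2 → Finset (ℤ × ℤ)
  | 0, 0 => {(-1, -1), (-1, 0), (-1, 1), (-1, 2), (0, -1), (0, 0), (0, 1), (1, -1), (1, 0), (2, -1)}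
  | 1, 0 => {(-1, -1), (-1, 0), (-1, 1), (0, -1), (0, 0), (1, -1)}
  | 1, 1 => {(1, 1), (1, 0), (1, -1), (1, -2), (0, 1), (0, 0), (0, -1), (-1, 1), (-1, 0), (-2, 1)}
  | 0, 1 => {(1, 1), (1, 0), (1, -1), (0, 1), (0, 0), (-1, 1)}

theorem mem_offsets_zero {i : Fin 2} {a b : ℤ} :
    (a, b) ∈ offsets i 0 ↔ -1 ≤ a ∧ -1 ≤ b ∧ a + b + (i : ℕ) ≤ 1 := by
  fin_cases i <;> simp [offsets] <;> omega

theorem mem_offsets_one {i : Fin 2} {a b : ℤ} :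
    (a, b) ∈ offsets i 1 ↔ a ≤ 1 ∧ b ≤ 1 ∧ 0 ≤ a + b + (i : ℕ) := by
  fin_cases i <;> simp [offsets] <;> omega

/-- The level set is a translate of the kernel, a proper subspace because of `y`, and proper
subspaces are null for Haar measure. -/
theorem volume_hyperplane (g : Plane →L[ℝ] ℝ) (y : Plane) (hy : g y ≠ 0) (c : ℝ) :
    volume {x | g x = c} = 0 := by
  have hker : volume (g.ker : Set Plane) = 0 :=
    Measure.addHaar_submodule _ _ fun e => hy (by
      have : y ∈ g.ker := e ▸ Submodule.mem_top
      simpa using this)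
  have : {x | g x = c} = (fun x => x + (-((c / g y) • y))) ⁻¹' (g.ker : Set Plane) := by
    ext x
    simp [hy]
    constructor <;> intro q <;> linarith
  rw [this, measure_preimage_add_right, hker]

/-- The grid lines form three countable families of null sets. Off them, questions about tiles
become questions about integer parts. -/
theorem ae_coord_ne :
    ∀ᵐ x : Plane, ∀ n : ℤ, coordS x ≠ n ∧ coordT x ≠ n ∧ coordS x + coordT x ≠ n := by
  have hp := h_pos
  rw [ae_all_iff]
  intro n
  let p0 : Plane →L[ℝ] ℝ := EuclideanSpace.proj 0
  let p1 : Plane →L[ℝ] ℝ := EuclideanSpace.proj 1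
  have e0 : ∀ x, p0 x = x 0 := fun _ => rfl
  have e1 : ∀ x, p1 x = x 1 := fun _ => rfl
  have key : ∀ a b c : ℝ, b ≠ 0 → ∀ᵐ x : Plane, a * x 0 + b * x 1 ≠ c := by
    intro a b c hb
    have := volume_hyperplane (a • p0 + b • p1) !₂[0, 1] (by simp [e0, e1, hb]) c
    rw [ae_iff]
    convert this using 2
    ext x
    simp [e0, e1]
  filter_upwards [key 0 (1 / (3 * h)) n (by positivity),
    key (1 / 2) (-(1 / (6 * h))) (n - 1 / 2) (by simp [hp.ne']),
    key (1 / 2) (1 / (6 * h)) (n - 1 / 2) (by simp [hp.ne'])] with x h1 h2 h3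
  refine ⟨fun q => h1 ?_, fun q => h2 ?_, fun q => h3 ?_⟩
  · rw [← q]; unfold coordS; ring
  · rw [← q]; unfold coordT; field_simp; ring
  · rw [← q]; unfold coordT coordS; field_simp; ring

theorem coordS_lineMap (c y : Plane) (r : ℝ) :
    coordS (c + r • (y - c)) = coordS c + r * (coordS y - coordS c) := by
  simp only [coordS, PiLp.add_apply, PiLp.smul_apply, PiLp.sub_apply, smul_eq_mul]; ring

theorem coordT_lineMap (c y : Plane) (r : ℝ) :
    coordT (c + r • (y - c)) = coordT c + r * (coordT y - coordT c) := by
  simp only [coordT, PiLp.add_apply, PiLp.smul_apply, PiLp.sub_apply, smul_eq_mul]; ring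

theorem coordS_tileCentre (i : Fin 2) (k j : ℤ) :
    coordS (tileCentre (i, k, j)) = k + (1 + (i : ℕ)) / 3 := by
  have hp := h_pos
  fin_cases i <;> simp [coordS, tileCentre] <;> field_simp <;> ring

theorem coordT_tileCentre (i : Fin 2) (k j : ℤ) :
    coordT (tileCentre (i, k, j)) = j + (1 + (i : ℕ)) / 3 := by
  have hp := h_pos
  fin_cases i <;> simp [coordT, tileCentre] <;> field_simp <;> ring

/-- The image of a tile under its stretching is, up to a null set, a union of sixteen tiles. -/
theorem image_tile_ae (a : Tile) :
    {y | tileCentre a + (1 / 4 : ℝ) • (y - tileCentre a) ∈ tileSet a} =ᵐ[volume]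
      ⋃ b ∈ (Finset.univ.sigma fun i => offsets i a.1),
        tileSet (b.1, a.2 + b.2) := by
  filter_upwards [ae_coord_ne] with y hy
  obtain ⟨i', k', j', hb⟩ : ∃ i k j, tile y = (i, k, j) := ⟨_, _, _, rfl⟩
  have hmem := mem_tileSet_iff.2 hb
  obtain ⟨i, k, j⟩ := a
  refine propext ?_
  have hR : y ∈ (⋃ b ∈ (Finset.univ.sigma fun l => offsets l i), tileSet (b.1, (k, j) + b.2)) ↔
      (k' - k, j' - j) ∈ offsets i' i := by
    simp only [Set.mem_iUnion, mem_tileSet_iff, hb]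
    constructor
    · rintro ⟨⟨l, d1, d2⟩, hd, e⟩
      simp only [Prod.mk_add_mk, Prod.mk.injEq] at e
      obtain ⟨rfl, rfl, rfl⟩ := e
      simpa using hd
    · intro hd
      exact ⟨⟨i', k' - k, j' - j⟩, by simpa using hd, by simp⟩
  change _ ↔ y ∈ (⋃ b ∈ (Finset.univ.sigma fun l => offsets l i), tileSet (b.1, (k, j) + b.2))
  rw [hR]
  have hS : (i' = 0 ∧ k' < coordS y ∧ j' < coordT y ∧ coordS y + coordT y < k' + j' + 1 ∨
      i' = 1 ∧ coordS y < k' + 1 ∧ coordT y < j' + 1 ∧ k' + j' + 1 < coordS y + coordT y) := by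
    fin_cases i'
    · refine Or.inl ⟨rfl, (mem_tileSet_zero (hy k').1 (hy j').2.1 ?_).1 hmem⟩
      exact_mod_cast (hy (k' + j' + 1)).2.2
    · exact Or.inr ⟨rfl, mem_tileSet_one.1 hmem⟩
  have castlt : ∀ (m n : ℤ) (x : ℝ), n < x → x < n + 1 → ((m : ℝ) < x ↔ m ≤ n) := by
    intro m n x h1 h2
    constructor
    · intro q
      have : (m : ℝ) < n + 1 := by linarith
      have : m < n + 1 := by exact_mod_cast this
      omega
    · intro q
      have : (m : ℝ) ≤ n := by exact_mod_cast q
      linarith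
  have castgt : ∀ (m n : ℤ) (x : ℝ), n < x → x < n + 1 → (x < (m : ℝ) ↔ n + 1 ≤ m) := by
    intro m n x h1 h2
    constructor
    · intro q
      have : (n : ℝ) < m := by linarith
      have : n < m := by exact_mod_cast this
      omega
    · intro q
      have : (n : ℝ) + 1 ≤ m := by exact_mod_cast q
      linarith
  -- The integer parts of s, t and s + t at `y` are k', j' and k' + j' + i', so they determine the
  -- tile. Comparing these coordinates with integers thus becomes integer arithmetic.
  have hs : k' < coordS y ∧ coordS y < k' + 1 := by rcases hS with h | h <;> constructor <;> linarith
  have ht : j' < coordT y ∧ coordT y < j' + 1 := by rcases hS with h | h <;> constructor <;> linarith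
  have hst : ((k' + j' + (i' : ℕ) : ℤ) : ℝ) < coordS y + coordT y ∧
      coordS y + coordT y < ((k' + j' + (i' : ℕ) : ℤ) : ℝ) + 1 := by
    rcases hS with ⟨rfl, h⟩ | ⟨rfl, h⟩ <;> push_cast <;> constructor <;> norm_num <;> linarith
  change tileCentre (i, k, j) + (1 / 4 : ℝ) • (y - tileCentre (i, k, j)) ∈ tileSet (i, k, j) ↔ _
  fin_cases i
  · have c1 := coordS_tileCentre 0 k j
    have c2 := coordT_tileCentre 0 k j
    change tileCentre (0, k, j) + (1 / 4 : ℝ) • (y - tileCentre (0, k, j)) ∈ tileSet (0, k, j) ↔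
      _ ∈ offsets _ 0
    rw [mem_offsets_zero, mem_tileSet_zero, coordS_lineMap, coordT_lineMap, c1, c2]
    -- The bounds of the stretched tile: k + 1/3 - 4/3 = k - 1, likewise j - 1, and k + j + 2/3 +
    -- 4/3 = k + j + 2. They are integers, so the image is cut out by grid lines.
    · have e1 := castlt (k - 1) _ _ hs.1 hs.2
      have e2 := castlt (j - 1) _ _ ht.1 ht.2
      have e3 := castgt (k + j + 2) _ _ hst.1 hst.2
      have : (-1 ≤ k' - k ∧ -1 ≤ j' - j ∧ k' - k + (j' - j) + (i' : ℕ) ≤ 1) ↔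
        (k - 1 ≤ k' ∧ j - 1 ≤ j' ∧ k' + j' + (i' : ℕ) + 1 ≤ k + j + 2) := by omega
      rw [this, ← e1, ← e2, ← e3]
      push_cast
      refine and_congr ?_ (and_congr ?_ ?_) <;> constructor <;> intro q <;> norm_num at q ⊢ <;>
        linarith
    · rw [coordS_lineMap, c1]
      intro q
      apply (hy (k - 1)).1
      push_cast
      norm_num at q
      linarith
    · rw [coordT_lineMap, c2]
      intro q
      apply (hy (j - 1)).2.1
      push_cast
      norm_num at q
      linarith
    · rw [coordS_lineMap, coordT_lineMap, c1, c2]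
      intro q
      apply (hy (k + j + 2)).2.2
      push_cast
      norm_num at q
      linarith
  · have c1 := coordS_tileCentre 1 k j
    have c2 := coordT_tileCentre 1 k j
    change tileCentre (1, k, j) + (1 / 4 : ℝ) • (y - tileCentre (1, k, j)) ∈ tileSet (1, k, j) ↔
      _ ∈ offsets _ 1
    rw [mem_offsets_one, mem_tileSet_one, coordS_lineMap, coordT_lineMap, c1, c2]
    -- The mirrored bounds: k + 2/3 + 4/3, likewise for j, and k + j + 4/3 - 4/3.
    have e1 := castgt (k + 2) _ _ hs.1 hs.2
    have e2 := castgt (j + 2) _ _ ht.1 ht.2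
    have e3 := castlt (k + j) _ _ hst.1 hst.2
    have : (k' - k ≤ 1 ∧ j' - j ≤ 1 ∧ 0 ≤ k' - k + (j' - j) + (i' : ℕ)) ↔
      (k' + 1 ≤ k + 2 ∧ j' + 1 ≤ j + 2 ∧ k + j ≤ k' + j' + (i' : ℕ)) := by omega
    rw [this, ← e1, ← e2, ← e3]
    push_cast
    refine and_congr ?_ (and_congr ?_ ?_) <;> constructor <;> intro q <;> norm_num at q ⊢ <;>
      linarith

theorem stretch_eq_on_tileSet (Λ : ℝ) {a : Tile} {x : Plane} (hx : x ∈ tileSet a) :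
    stretch Λ x = tileCentre a + Λ • (x - tileCentre a) := by
  rw [stretch, centre_eq_tileCentre, mem_tileSet_iff.1 hx]

/-- The image of the uniform measure on a tile. -/
theorem map_stretch_restrict (a : Tile) :
    (volume.restrict (tileSet a)).map (stretch 4) =
      (1 / 16 : ℝ≥0∞) • ∑ i, ∑ d ∈ offsets i a.1, volume.restrict (tileSet (i, a.2 + d)) := by
  have h1 : (volume.restrict (tileSet a)).map (stretch 4) =
      (volume.restrict (tileSet a)).map fun x => tileCentre a + (4 : ℝ) • (x - tileCentre a) := by
    refine Measure.map_congr ?_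
    filter_upwards [ae_restrict_mem (measurableSet_tileSet a)] with x hx
    exact stretch_eq_on_tileSet 4 hx
  have hm : Measurable fun x : Plane => tileCentre a + (4 : ℝ) • (x - tileCentre a) := by fun_prop
  have hvol : (volume : Measure Plane).map (fun x => tileCentre a + (4 : ℝ) • (x - tileCentre a)) =
      (1 / 16 : ℝ≥0∞) • volume := by
    have e : (fun x : Plane => tileCentre a + (4 : ℝ) • (x - tileCentre a)) =
        (fun x => x + (tileCentre a - (4 : ℝ) • tileCentre a)) ∘ fun x => (4 : ℝ) • x := by
      ext1 x
      simp only [Function.comp, smul_sub]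
      abel
    rw [e, ← Measure.map_map (by fun_prop) (by fun_prop),
      Measure.map_addHaar_smul _ (by norm_num : (4 : ℝ) ≠ 0), Measure.map_smul,
      map_add_right_eq_self]
    congr 1
    rw [finrank_euclideanSpace, Fintype.card_fin, abs_of_pos (by positivity),
      ENNReal.ofReal_inv_of_pos (by positivity)]
    norm_num
  -- `B` is the image of the tile, written as a preimage under the inverse homothety. The
  -- pushforward of the restricted volume is the restriction to `B` of the pushed volume, with
  -- Jacobian factor 1/16.
  let B : Set Plane := {y | tileCentre a + (1 / 4 : ℝ) • (y - tileCentre a) ∈ tileSet a}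
  have hB : MeasurableSet B :=
    (by fun_prop : Measurable fun y : Plane =>
      tileCentre a + (1 / 4 : ℝ) • (y - tileCentre a)) (measurableSet_tileSet a)
  have hpre : (fun x : Plane => tileCentre a + (4 : ℝ) • (x - tileCentre a)) ⁻¹' B = tileSet a := by
    ext x
    simp [B, smul_smul]
  rw [h1, ← hpre, ← Measure.restrict_map hm hB, hvol, Measure.restrict_smul,
    Measure.restrict_congr_set (image_tile_ae a), Measure.restrict_biUnion_finset]
  · rw [Measure.sum_fintype,
      Finset.sum_coe_sort (Finset.univ.sigma fun i => offsets i a.1)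
        (fun b => volume.restrict (tileSet (b.1, a.2 + b.2))), Finset.sum_sigma]
  · rintro ⟨i, d⟩ - ⟨i', d'⟩ - hne
    refine pairwise_disjoint_tileSet fun e => hne ?_
    simp only [Prod.mk.injEq, add_right_inj] at e
    obtain ⟨rfl, rfl⟩ := e
    rfl
  · exact fun _ => measurableSet_tileSet _

/-! ### The area of the tiles -/

theorem volume_tileSet_eq_zero_index (i : Fin 2) (z : ℤ × ℤ) :
    volume (tileSet (i, z)) = volume (tileSet (i, 0)) := by
  have : tileSet (i, z) =
      (fun x => x + (tileCentre (i, 0) - tileCentre (i, z))) ⁻¹' tileSet (i, 0) := by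
    ext x
    have e : ∀ l, (x + (tileCentre (i, 0) - tileCentre (i, z))) l - tileCentre (i, 0) l =
        x l - tileCentre (i, z) l := fun l => by
      simp only [PiLp.add_apply, PiLp.sub_apply]; ring
    rw [Set.mem_preimage]
    unfold tileSet
    fin_cases i
    · simp only [mem_triangle_zero, Fin.zero_eta, e] at *
    · simp only [mem_triangle_one, Fin.mk_one, e] at *
  rw [this, measure_preimage_add_right]

theorem volume_parallelogram :
    volume {x : Plane | coordS x ∈ Set.Ioo 0 1 ∧ coordT x ∈ Set.Ioo 0 1} =
      ENNReal.ofReal (6 * h) := by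
  have hp := h_pos
  let M : Matrix (Fin 2) (Fin 2) ℝ := !![0, 1 / (3 * h); 1 / 2, -(1 / (6 * h))]
  have hM : M.det = -(1 / (6 * h)) := by
    simp [M, Matrix.det_fin_two]; field_simp; norm_num
  -- `M` is the linear part of (s, t); the constant 1/2 in t is absorbed by shifting the second
  -- interval.
  let Q : Set (Fin 2 → ℝ) := Set.pi Set.univ fun i => Set.Ioo (![0, -1 / 2] i) (![1, 1 / 2] i)
  have hQ : MeasurableSet Q := MeasurableSet.univ_pi fun _ => measurableSet_Ioo
  have hpre : {x : Plane | coordS x ∈ Set.Ioo 0 1 ∧ coordT x ∈ Set.Ioo 0 1} =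
      (WithLp.ofLp) ⁻¹' ((Matrix.toLin' M) ⁻¹' Q) := by
    ext x
    simp only [Set.mem_ofPred_eq, Set.mem_preimage, Q, Set.mem_univ_pi, Fin.forall_fin_two,
      Matrix.toLin'_apply, Matrix.mulVec, dotProduct, Fin.sum_univ_two, M, coordS, coordT,
      Set.mem_Ioo]
    simp
    refine and_congr ?_ (and_congr ?_ ?_)
    · rw [div_eq_inv_mul, mul_inv_rev]
    · constructor <;> intro q <;> field_simp at q ⊢ <;> linarith
    · constructor <;> intro q <;> field_simp at q ⊢ <;> linarith
  have hm : MeasurableSet ((Matrix.toLin' M) ⁻¹' Q) :=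
    (LinearMap.continuous_of_finiteDimensional _).measurable hQ
  rw [hpre, (PiLp.volume_preserving_ofLp (Fin 2)).measure_preimage
    hm.nullMeasurableSet,
    ← Measure.map_apply (LinearMap.continuous_of_finiteDimensional _).measurable hQ,
    Real.map_matrix_volume_pi_eq_smul_volume_pi (by rw [hM]; simp [hp.ne']), hM,
    Measure.smul_apply, Real.volume_pi_Ioo]
  simp [Fin.prod_univ_two, abs_of_pos hp]
  norm_num

theorem volume_tileSet (a : Tile) : volume (tileSet a) = ENNReal.ofReal (3 * h) := by
  have hp := h_pos
  have hfin : ∀ i, volume (tileSet (i, 0)) ≠ ∞ := by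
    intro i
    have hb : ∀ s : Set Plane, s.Finite → volume (convexHull ℝ s) ≠ ∞ := fun s hs =>
      ((isBounded_convexHull.2 hs.isBounded).measure_lt_top).ne
    fin_cases i
    · exact measure_ne_top_of_subset Set.sdiff_subset (hb _ (by simp))
    · exact measure_ne_top_of_subset interior_subset (hb _ (by simp))
  have hsum : volume (tileSet (0, 0)) + volume (tileSet (1, 0)) = ENNReal.ofReal (6 * h) := by
    rw [← volume_parallelogram, ← measure_union (pairwise_disjoint_tileSet (by simp))
      (measurableSet_tileSet _)]
    refine measure_congr ?_
    filter_upwards [ae_coord_ne] with x hx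
    refine propext ?_
    have h0 := hx 0
    have h1 := hx 1
    push_cast at h0 h1
    change x ∈ tileSet (0, 0, 0) ∪ tileSet (1, 0, 0) ↔
      coordS x ∈ Set.Ioo 0 1 ∧ coordT x ∈ Set.Ioo 0 1
    rw [Set.mem_union, mem_tileSet_one, mem_tileSet_zero (by simpa using h0.1)
      (by simpa using h0.2.1) (by simpa using h1.2.2)]
    simp only [Set.mem_Ioo]
    push_cast
    constructor
    · rintro (⟨q1, q2, q3⟩ | ⟨q1, q2, q3⟩) <;> refine ⟨⟨?_, ?_⟩, ?_, ?_⟩ <;> linarith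
    · rintro ⟨⟨q1, q2⟩, q3, q4⟩
      rcases lt_or_gt_of_ne h1.2.2 with q | q
      · left; refine ⟨q1, q3, ?_⟩; linarith
      · right; refine ⟨?_, ?_, ?_⟩ <;> linarith
  -- Conservation of mass replaces a second area computation: it gives v₀ = (10 v₀ + 6 v₁)/16, so
  -- the two types have equal area, half of the parallelogram.
  have hmass := congrArg (fun μ => μ Set.univ) (map_stretch_restrict (0, 0))
  simp only [Measure.map_apply (measurable_stretch 4) MeasurableSet.univ, Set.preimage_univ,
    Measure.restrict_apply_univ, Measure.smul_apply, Measure.add_apply, Measure.finsetSum_apply, Fin.sum_univ_two,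
    volume_tileSet_eq_zero_index _ (_ + _), Finset.sum_const] at hmass
  obtain ⟨i, z⟩ := a
  rw [volume_tileSet_eq_zero_index]
  have hc0 : (offsets 0 0).card = 10 := by decide
  have hc1 : (offsets 1 0).card = 6 := by decide
  rw [hc0, hc1] at hmass
  obtain ⟨v, hv⟩ : ∃ v : Fin 2 → ℝ, ∀ i, 0 ≤ v i ∧ volume (tileSet (i, 0)) = ENNReal.ofReal (v i) :=
    ⟨fun i => (volume (tileSet (i, 0))).toReal, fun i =>
      ⟨ENNReal.toReal_nonneg, (ENNReal.ofReal_toReal (hfin i)).symm⟩⟩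
  rw [(hv 0).2, (hv 1).2] at hsum hmass
  rw [← ENNReal.ofReal_add (hv 0).1 (hv 1).1,
    ENNReal.ofReal_eq_ofReal_iff (add_nonneg (hv 0).1 (hv 1).1) (by positivity)] at hsum
  have hmass' := congrArg ENNReal.toReal hmass
  have t0 := ENNReal.toReal_ofReal (hv 0).1
  have t1 := ENNReal.toReal_ofReal (hv 1).1
  rw [smul_eq_mul, ENNReal.toReal_mul, nsmul_eq_mul, nsmul_eq_mul,
    ENNReal.toReal_add (ENNReal.mul_ne_top (by simp) (by simp))
      (ENNReal.mul_ne_top (by simp) (by simp))] at hmass'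
  simp [t0, t1] at hmass'
  have : ∀ i, v i = 3 * h := by
    intro i
    fin_cases i <;> simp <;> linarith
  rw [(hv i).2, this]

/-! ### Evolution of tile weights and the matrix convolution -/

/-- The measure with the given constant density on each tile. -/
noncomputable def tileMeasure (w : Tile → ℝ≥0∞) : Measure Plane :=
  Measure.sum fun a => w a • volume.restrict (tileSet a)

/-- The evolution of the weights of the tiles. -/
noncomputable def evolve (w : Tile → ℝ≥0∞) (a : Tile) : ℝ≥0∞ :=
  (1 / 16) * ∑ j, ∑ d ∈ offsets a.1 j, w (j, a.2 - d)

theorem tsum_tile (f : Tile → ℝ≥0∞) : ∑' a, f a = ∑ i, ∑' z, f (i, z) := by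
  rw [ENNReal.tsum_prod', tsum_fintype]

/-- Summation by parts: the shift of the weights is transferred to the test values. Applied to areas
it gives the evolution of measures, and to indicators of centres the convolution formula. -/
theorem tsum_evolve_mul (w : Tile → ℝ≥0∞) (i : Fin 2) (V : ℤ × ℤ → ℝ≥0∞) :
    ∑' z, evolve w (i, z) * V z =
      (1 / 16) * ∑ j, ∑ d ∈ offsets i j, ∑' z, w (j, z) * V (z + d) := by
  simp only [evolve, mul_assoc, ENNReal.tsum_mul_left, Finset.sum_mul]
  congr 1
  rw [Summable.tsum_finsetSum fun _ _ => ENNReal.summable]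
  refine Finset.sum_congr rfl fun j _ => ?_
  rw [Summable.tsum_finsetSum fun _ _ => ENNReal.summable]
  refine Finset.sum_congr rfl fun d _ => ?_
  rw [← (Equiv.addRight d).tsum_eq]
  simp

theorem lintegral_tileMeasure (w : Tile → ℝ≥0∞) (f : Plane → ℝ≥0∞) :
    ∫⁻ x, f x ∂(tileMeasure w) = ∑' a, w a * ∫⁻ x in tileSet a, f x := by
  simp [tileMeasure, lintegral_sum_measure]

theorem tileMeasure_apply (w : Tile → ℝ≥0∞) {s : Set Plane} (hs : MeasurableSet s) :
    tileMeasure w s = ∑' a, w a * volume.restrict (tileSet a) s := by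
  simp [tileMeasure, Measure.sum_apply _ hs]

theorem map_stretch_tileMeasure (w : Tile → ℝ≥0∞) :
    (tileMeasure w).map (stretch 4) = tileMeasure (evolve w) := by
  ext s hs
  have hm := measurable_stretch 4
  rw [Measure.map_apply hm hs, tileMeasure_apply _ (hm hs), tileMeasure_apply _ hs, tsum_tile,
    tsum_tile]
  simp only [tsum_evolve_mul, ← Measure.map_apply hm hs, map_stretch_restrict]
  have hR : ∀ j, ∑' z, w (j, z) * ((1 / 16 : ℝ≥0∞) • ∑ i, ∑ d ∈ offsets i j,
      volume.restrict (tileSet (i, z + d))) s =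
      (1 / 16) * ∑ i, ∑ d ∈ offsets i j, ∑' z, w (j, z) * volume.restrict (tileSet (i, z + d)) s := by
    intro j
    have e : ∑' z, ∑ i, ∑ d ∈ offsets i j, w (j, z) * volume.restrict (tileSet (i, z + d)) s =
        ∑ i, ∑ d ∈ offsets i j, ∑' z, w (j, z) * volume.restrict (tileSet (i, z + d)) s := by
      rw [Summable.tsum_finsetSum fun _ _ => ENNReal.summable]
      exact Finset.sum_congr rfl fun i _ => Summable.tsum_finsetSum fun _ _ => ENNReal.summable
    rw [← e]
    rw [← ENNReal.tsum_mul_left]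
    refine tsum_congr fun z => ?_
    simp only [Measure.smul_apply, Measure.finsetSum_apply, smul_eq_mul, Finset.mul_sum]
    refine Finset.sum_congr rfl fun i _ => Finset.sum_congr rfl fun d _ => ?_
    rw [mul_left_comm]
  rw [Finset.sum_congr rfl fun j _ => hR j, ← Finset.mul_sum, ← Finset.mul_sum, Finset.sum_comm]

theorem tileMeasure_eq_withDensity (w : Tile → ℝ≥0∞) :
    tileMeasure w = volume.withDensity fun x => w (tile x) := by
  ext s hs
  rw [tileMeasure_apply _ hs, withDensity_apply _ hs, ← Measure.restrict_univ (μ := volume.restrict s),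
    ← iUnion_tileSet, Measure.restrict_iUnion pairwise_disjoint_tileSet measurableSet_tileSet,
    lintegral_sum_measure]
  refine tsum_congr fun a => ?_
  rw [setLIntegral_congr_fun (measurableSet_tileSet a) (g := fun _ => w a)
    (fun x hx => by rw [mem_tileSet_iff.1 hx])]
  rw [lintegral_const, Measure.restrict_apply hs, Measure.restrict_apply_univ,
    Measure.restrict_apply (measurableSet_tileSet a), Set.inter_comm]

theorem tileCentre_mem_tileSet (a : Tile) : tileCentre a ∈ tileSet a := by
  have hp := h_pos
  obtain ⟨i, z⟩ := a
  unfold tileSet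
  fin_cases i
  · simp only [Fin.zero_eta, mem_triangle_zero]
    simp [hp.le]
  · simp only [Fin.mk_one, mem_triangle_one]
    simp [hp]

/-- Lets a tile-wise constant density be encoded by its values at the centres. -/
theorem HasTriangleDensity.eq_apply_tile {μ : Measure Plane} {ρ : Plane → ℝ}
    (hρ : HasTriangleDensity μ ρ) (x : Plane) : ρ x = ρ (tileCentre (tile x)) :=
  hρ.const _ _ (tileCentre_mem_centres (tile x)) _ (mem_tileSet_tile x) _ (tileCentre_mem_tileSet _)

theorem HasTriangleDensity.eq_tileMeasure {μ : Measure Plane} {ρ : Plane → ℝ}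
    (hρ : HasTriangleDensity μ ρ) :
    μ = tileMeasure fun a => ENNReal.ofReal (ρ (tileCentre a)) := by
  rw [tileMeasure_eq_withDensity, hρ.eq_withDensity]
  simp only [← hρ.eq_apply_tile]

theorem hasTriangleDensity_tileMeasure {w : Tile → ℝ≥0∞} (hw : ∀ a, w a ≠ ∞) :
    HasTriangleDensity (tileMeasure w) fun x => (w (tile x)).toReal where
  nonneg _ := ENNReal.toReal_nonneg
  const i c hc x hx y hy := by
    obtain ⟨z, rfl⟩ := exists_tileCentre_eq hc
    rw [(mem_tileSet_iff (a := (i, z))).1 hx, (mem_tileSet_iff (a := (i, z))).1 hy]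
  eq_withDensity := by
    rw [tileMeasure_eq_withDensity]
    simp only [ENNReal.ofReal_toReal (hw _)]

theorem evolve_ne_top {w : Tile → ℝ≥0∞} (hw : ∀ a, w a ≠ ∞) (a : Tile) : evolve w a ≠ ∞ :=
  ENNReal.mul_ne_top (by simp) (ENNReal.sum_ne_top.2 fun _ _ => ENNReal.sum_ne_top.2 fun _ _ => hw _)

theorem perronFrobenius_iterate_tileMeasure (w : Tile → ℝ≥0∞) (n : ℕ) :
    (perronFrobenius (stretch 4))^[n] (tileMeasure w) = tileMeasure (evolve^[n] w) := by
  induction n with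
  | zero => rfl
  | succ n ih =>
    rw [Function.iterate_succ_apply', Function.iterate_succ_apply', ih, perronFrobenius,
      map_stretch_tileMeasure]

theorem region_eq (i : Fin 2) : region i = ⋃ z, tileSet (i, z) := by
  ext x
  simp only [region, Set.mem_iUnion]
  constructor
  · rintro ⟨c, hc, hx⟩
    obtain ⟨z, rfl⟩ := exists_tileCentre_eq hc
    exact ⟨z, hx⟩
  · rintro ⟨z, hx⟩
    exact ⟨_, tileCentre_mem_centres (i, z), hx⟩

theorem atCentres_tileMeasure (w : Tile → ℝ≥0∞) (i : Fin 2) :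
    atCentres (tileMeasure w) i = ENNReal.ofReal (3 * h) •
      Measure.sum fun z => w (i, z) • Measure.dirac (tileCentre (i, z)) := by
  have hreg : MeasurableSet (region i) := by
    rw [region_eq]; exact MeasurableSet.iUnion fun _ => measurableSet_tileSet _
  ext s hs
  have hcs := measurable_centre hs
  rw [atCentres, Measure.map_apply measurable_centre hs, Measure.restrict_apply hcs,
    tileMeasure_apply _ (hcs.inter hreg), tsum_tile, Finset.sum_eq_single i]
  · rw [Measure.smul_apply, Measure.sum_apply _ hs, smul_eq_mul, ← ENNReal.tsum_mul_left]
    refine tsum_congr fun z => ?_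
    rw [Measure.smul_apply, smul_eq_mul, Measure.dirac_apply' _ hs, mul_left_comm]
    congr 1
    rw [Measure.restrict_apply (hcs.inter hreg)]
    have hsub : tileSet (i, z) ⊆ region i := by
      rw [region_eq]; exact Set.subset_iUnion (fun z => tileSet (i, z)) z
    by_cases hz : tileCentre (i, z) ∈ s
    · have : centre ⁻¹' s ∩ region i ∩ tileSet (i, z) = tileSet (i, z) := by
        refine Set.inter_eq_right.2 fun x hx => ⟨?_, hsub hx⟩
        rw [Set.mem_preimage, centre_eq_tileCentre, mem_tileSet_iff.1 hx]
        exact hz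
      rw [this, volume_tileSet, Set.indicator_of_mem hz]
      simp
    · have : centre ⁻¹' s ∩ region i ∩ tileSet (i, z) = ∅ := by
        refine Set.eq_empty_of_forall_notMem ?_
        rintro x ⟨⟨hx, -⟩, hx'⟩
        rw [Set.mem_preimage, centre_eq_tileCentre, mem_tileSet_iff.1 hx'] at hx
        exact hz hx
      rw [this, Set.indicator_of_notMem hz]
      simp
  · intro i' _ hi
    refine ENNReal.tsum_eq_zero.2 fun z => ?_
    rw [Measure.restrict_apply (hcs.inter hreg), region_eq]
    have : centre ⁻¹' s ∩ (⋃ z, tileSet (i, z)) ∩ tileSet (i', z) = ∅ := by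
      refine Set.eq_empty_of_forall_notMem ?_
      rintro x ⟨⟨-, hx⟩, hx'⟩
      obtain ⟨z', hz'⟩ := Set.mem_iUnion.1 hx
      exact hi (congrArg Prod.fst (eq_of_mem_tileSet hx' hz'))
    rw [this]
    simp
  · simp

/-- The displacement between centres depends only on the offset and the two types, which is why the
evolution is a convolution. -/
theorem tileCentre_add (i j : Fin 2) (z d : ℤ × ℤ) :
    tileCentre (i, z + d) = (tileCentre (i, d) - tileCentre (j, 0)) + tileCentre (j, z) := by
  obtain ⟨k, l⟩ := z
  obtain ⟨k', l'⟩ := d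
  rw [show (0 : ℤ × ℤ) = (0, 0) from rfl, Prod.mk_add_mk]
  ext m
  fin_cases i <;> fin_cases j <;> fin_cases m <;> simp [tileCentre] <;> ring

theorem E_eq (i j : Fin 2) : E i j =
    (1 / 16 : ℝ≥0∞) • ∑ d ∈ offsets i j, Measure.dirac (tileCentre (i, d) - tileCentre (j, 0)) := by
  have key : ∀ d : ℤ × ℤ, Measure.dirac (tileCentre (i, d) - tileCentre (j, 0)) =
      δ (d.1 + 2 * d.2 + (i : ℕ) - (j : ℕ)) (3 * d.1 + (i : ℕ) - (j : ℕ)) := by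
    rintro ⟨k, l⟩
    rw [δ]
    congr 1
    rw [show (0 : ℤ × ℤ) = (0, 0) from rfl]
    ext m
    fin_cases i <;> fin_cases j <;> fin_cases m <;> simp [tileCentre] <;> ring
  simp only [key]
  fin_cases i <;> fin_cases j
  · norm_num [E, kernelSame, offsets, Finset.sum_insert, -one_div]
    ext s -
    simp only [Measure.add_apply, Measure.smul_apply, smul_eq_mul]
    ring
  · norm_num [E, kernelOther, offsets, Finset.sum_insert, -one_div]
    ext s -
    simp only [Measure.add_apply, Measure.smul_apply, smul_eq_mul]
    ring
  · norm_num [E, kernelOther, offsets, Finset.sum_insert, -one_div]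
    ext s -
    simp only [Measure.add_apply, Measure.smul_apply, smul_eq_mul]
    ring
  · norm_num [E, kernelSame, offsets, Finset.sum_insert, -one_div]
    ext s -
    simp only [Measure.add_apply, Measure.smul_apply, smul_eq_mul]
    ring

theorem atCentres_evolve (w : Tile → ℝ≥0∞) (i : Fin 2) (hw : ∀ j, SFinite (atCentres (tileMeasure w) j)) :
    atCentres (tileMeasure (evolve w)) i = ∑ j, E i j ∗ atCentres (tileMeasure w) j := by
  ext s hs
  have hf : Measurable (s.indicator (1 : Plane → ℝ≥0∞)) := measurable_one.indicator hs
  have hconv : ∀ j, (E i j ∗ atCentres (tileMeasure w) j) s =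
      ENNReal.ofReal (3 * h) * ((1 / 16) * ∑ d ∈ offsets i j,
        ∑' z, w (j, z) * s.indicator 1 (tileCentre (i, z + d))) := by
    intro j
    rw [← lintegral_indicator_one hs, Measure.lintegral_conv hf, E_eq]
    simp only [lintegral_smul_measure, lintegral_finsetSum_measure, atCentres_tileMeasure,
      lintegral_sum_measure, lintegral_dirac, tileCentre_add i j, smul_eq_mul, Finset.mul_sum]
    refine Finset.sum_congr rfl fun d _ => ?_
    rw [mul_left_comm]
  rw [Measure.finsetSum_apply, Finset.sum_congr rfl fun j _ => hconv j, ← Finset.mul_sum,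
    ← Finset.mul_sum, ← tsum_evolve_mul w i fun z => s.indicator 1 (tileCentre (i, z)),
    atCentres_tileMeasure, Measure.smul_apply, Measure.sum_apply _ hs, smul_eq_mul]
  simp [Measure.dirac_apply' _ hs]

/-! ### Mean square displacement and the diffusion coefficient -/

theorem tendsto_one_div_sqrt : Tendsto (fun n : ℕ => 1 / √(n : ℝ)) atTop (𝓝 0) := by
  have := tendsto_inv_atTop_zero.comp
    (Real.tendsto_sqrt_atTop.comp tendsto_natCast_atTop_atTop)
  simpa [Function.comp_def] using this

/-- The sixteen displacements sum to zero, so the cross terms vanish, and their squared lengths have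
average 5. This is the source of the coefficient 5/4. -/
theorem sum_norm_sq_tileCentre_sub (a : Tile) (p : Plane) :
    ∑ i, ∑ d ∈ offsets i a.1, ‖tileCentre (i, a.2 + d) - p‖ ^ 2 =
      16 * (‖tileCentre a - p‖ ^ 2 + 5) := by
  have h3 := three_h_sq
  obtain ⟨j, k, l⟩ := a
  simp only [EuclideanSpace.norm_sq_eq, Fin.sum_univ_two, Real.norm_eq_abs, sq_abs]
  fin_cases j
  · simp [offsets, tileCentre]
    linear_combination 40 * h3
  · simp [offsets, tileCentre]
    linear_combination 40 * h3

/-- Induction on the first step: f pushes the uniform measure on `a` to the average over its sixteen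
image tiles, and each step adds 5 for any reference point `p`. -/
theorem setLIntegral_norm_sq_centre_iterate (n : ℕ) (a : Tile) (p : Plane) :
    ∫⁻ x in tileSet a, ENNReal.ofReal (‖centre ((stretch 4)^[n] x) - p‖ ^ 2) =
      ENNReal.ofReal (3 * h) * ENNReal.ofReal (‖tileCentre a - p‖ ^ 2 + 5 * n) := by
  have hp := h_pos
  induction n generalizing a with
  | zero =>
    rw [setLIntegral_congr_fun (measurableSet_tileSet a)
      (g := fun _ => ENNReal.ofReal (‖tileCentre a - p‖ ^ 2)) (fun x hx => by
        simp [centre_eq_tileCentre, mem_tileSet_iff.1 hx])]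
    simp [volume_tileSet, mul_comm]
  | succ n ih =>
    have hm : Measurable fun x => ENNReal.ofReal (‖centre ((stretch 4)^[n] x) - p‖ ^ 2) := by
      have := measurable_centre.comp ((measurable_stretch 4).iterate n)
      simp only [Function.comp_def] at this
      fun_prop
    have := lintegral_map (μ := volume.restrict (tileSet a)) hm (measurable_stretch 4)
    simp only [Function.iterate_succ_apply]
    rw [← this, map_stretch_restrict]
    simp only [lintegral_smul_measure, lintegral_finsetSum_measure, ih, smul_eq_mul]
    simp only [← Finset.mul_sum]
    rw [mul_left_comm]
    congr 1
    have e := sum_norm_sq_tileCentre_sub a p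
    have e2 : ∑ i, ∑ d ∈ offsets i a.1, (‖tileCentre (i, a.2 + d) - p‖ ^ 2 + 5 * (n : ℝ)) =
        16 * (‖tileCentre a - p‖ ^ 2 + 5 * (n + 1 : ℕ)) := by
      have hcard : ∀ j, ((offsets 0 j).card : ℝ) + (offsets 1 j).card = 16 := by
        intro j
        have : (offsets 0 j).card + (offsets 1 j).card = 16 := by fin_cases j <;> decide
        exact_mod_cast this
      simp only [Finset.sum_add_distrib, Finset.sum_const, nsmul_eq_mul]
      rw [e, Fin.sum_univ_two]
      push_cast
      linear_combination 5 * (n : ℝ) * hcard a.1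
    have e3 : ∑ i, ∑ d ∈ offsets i a.1,
        ENNReal.ofReal (‖tileCentre (i, a.2 + d) - p‖ ^ 2 + 5 * (n : ℝ)) =
        ENNReal.ofReal (16 * (‖tileCentre a - p‖ ^ 2 + 5 * (n + 1 : ℕ))) := by
      rw [← e2, ENNReal.ofReal_sum_of_nonneg fun i _ => Finset.sum_nonneg fun d _ => by positivity]
      refine Finset.sum_congr rfl fun i _ => ?_
      rw [ENNReal.ofReal_sum_of_nonneg fun d _ => by positivity]
    rw [e3, ENNReal.ofReal_mul (by norm_num), ← mul_assoc, ENNReal.ofReal_ofNat, one_div,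
      ENNReal.inv_mul_cancel (by norm_num) (by norm_num), one_mul]

theorem lintegral_norm_sq_centre_iterate_sub (w : Tile → ℝ≥0∞) [IsProbabilityMeasure (tileMeasure w)]
    (n : ℕ) :
    ∫⁻ x, ENNReal.ofReal (‖centre ((stretch 4)^[n] x) - centre x‖ ^ 2) ∂(tileMeasure w) =
      ENNReal.ofReal (5 * n) := by
  rw [lintegral_tileMeasure]
  have : ∀ a, ∫⁻ x in tileSet a, ENNReal.ofReal (‖centre ((stretch 4)^[n] x) - centre x‖ ^ 2) =
      volume.restrict (tileSet a) Set.univ * ENNReal.ofReal (5 * n) := by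
    intro a
    rw [setLIntegral_congr_fun (measurableSet_tileSet a)
      (g := fun x => ENNReal.ofReal (‖centre ((stretch 4)^[n] x) - tileCentre a‖ ^ 2)) (fun x hx => by
        simp only [centre_eq_tileCentre x, mem_tileSet_iff.1 hx]),
      setLIntegral_norm_sq_centre_iterate]
    simp [volume_tileSet]
  simp only [this, ← mul_assoc, ENNReal.tsum_mul_right]
  rw [← tileMeasure_apply w MeasurableSet.univ, measure_univ, one_mul]

theorem norm_sub_centre_le (x : Plane) : ‖x - centre x‖ ≤ 2 := by
  have hp := h_pos
  have h3 := three_h_sq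
  rw [centre_eq_tileCentre]
  have hx := mem_tileSet_tile x
  generalize tile x = a at *
  obtain ⟨i, z⟩ := a
  have key : |x 1 - tileCentre (i, z) 1| ≤ 2 * h ∧ |3 * h * (x 0 - tileCentre (i, z) 0)| ≤ 3 * h := by
    rw [abs_le, abs_le]
    unfold tileSet at hx
    fin_cases i
    · simp only [Fin.zero_eta, mem_triangle_zero] at hx ⊢
      obtain ⟨q1, q2, q3, -⟩ := hx
      refine ⟨⟨?_, ?_⟩, ?_, ?_⟩ <;> linarith
    · simp only [Fin.mk_one, mem_triangle_one] at hx ⊢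
      obtain ⟨q1, q2, q3⟩ := hx
      refine ⟨⟨?_, ?_⟩, ?_, ?_⟩ <;> linarith
  obtain ⟨k1, k2⟩ := key
  rw [abs_mul, abs_of_pos (by positivity : 0 < 3 * h)] at k2
  have k2' : |x 0 - tileCentre (i, z) 0| ≤ 1 := by
    by_contra q
    push Not at q
    nlinarith
  refine le_of_sq_le_sq ?_ (by norm_num)
  rw [EuclideanSpace.norm_sq_eq, Fin.sum_univ_two]
  simp only [PiLp.sub_apply, Real.norm_eq_abs]
  nlinarith [abs_nonneg (x 0 - tileCentre (i, z) 0), abs_nonneg (x 1 - tileCentre (i, z) 1)]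

/-- The cross term 2K‖v‖ is split by the inequality of arithmetic and geometric means, so that only
‖v‖² has to be integrated. -/
theorem abs_norm_sq_sub_norm_sq_le {V : Type*} [SeminormedAddCommGroup V] {u v : V} {K ε : ℝ}
    (hε : 0 < ε) (huv : ‖u - v‖ ≤ K) :
    |‖u‖ ^ 2 - ‖v‖ ^ 2| ≤ ε * ‖v‖ ^ 2 + (K ^ 2 / ε + K ^ 2) := by
  have hK : 0 ≤ K := (norm_nonneg _).trans huv
  have h1 : |‖u‖ - ‖v‖| ≤ K := (abs_norm_sub_norm_le u v).trans huv
  have h2 : 2 * K * ‖v‖ ≤ ε * ‖v‖ ^ 2 + K ^ 2 / ε := by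
    have : 0 ≤ (ε * ‖v‖ - K) ^ 2 / ε := by positivity
    have e : (ε * ‖v‖ - K) ^ 2 / ε = ε * ‖v‖ ^ 2 + K ^ 2 / ε - 2 * K * ‖v‖ := by
      field_simp; ring
    linarith
  have h3 : |‖u‖ ^ 2 - ‖v‖ ^ 2| ≤ K * (K + 2 * ‖v‖) := by
    rw [show ‖u‖ ^ 2 - ‖v‖ ^ 2 = (‖u‖ - ‖v‖) * (‖u‖ + ‖v‖) by ring, abs_mul]
    refine mul_le_mul h1 ?_ (abs_nonneg _) hK
    rw [abs_of_nonneg (by positivity)]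
    linarith [(abs_le.1 h1).2]
  linarith

theorem tendsto_mean_norm_sq_iterate_sub (w : Tile → ℝ≥0∞) [IsProbabilityMeasure (tileMeasure w)] :
    Tendsto (fun n : ℕ => (∫ x, ‖(stretch 4)^[n] x - x‖ ^ 2 ∂(tileMeasure w)) / (4 * n))
      atTop (𝓝 (5 / 4)) := by
  set μ := tileMeasure w
  have hm := measurable_centre
  have hmn : ∀ n, Measurable (stretch 4)^[n] := (measurable_stretch 4).iterate
  have hmcn : ∀ n, Measurable fun x => centre ((stretch 4)^[n] x) := fun n => hm.comp (hmn n)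
  have hD : ∀ n, Measurable fun x => ‖centre ((stretch 4)^[n] x) - centre x‖ ^ 2 := fun n => by
    have := hmcn n
    fun_prop
  have hG : ∀ n, Measurable fun x => ‖(stretch 4)^[n] x - x‖ ^ 2 := fun n => by
    have := hmn n
    fun_prop
  have hDi : ∀ n, Integrable (fun x => ‖centre ((stretch 4)^[n] x) - centre x‖ ^ 2) μ := by
    intro n
    refine ⟨(hD n).aestronglyMeasurable, ?_⟩
    rw [hasFiniteIntegral_iff_ofReal (ae_of_all _ fun x => by positivity),
      lintegral_norm_sq_centre_iterate_sub]
    exact ENNReal.ofReal_lt_top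
  have hDv : ∀ n : ℕ, ∫ x, ‖centre ((stretch 4)^[n] x) - centre x‖ ^ 2 ∂μ = 5 * n := by
    intro n
    rw [integral_eq_lintegral_of_nonneg_ae (ae_of_all _ fun x => by positivity)
      (hD n).aestronglyMeasurable, lintegral_norm_sq_centre_iterate_sub,
      ENNReal.toReal_ofReal (by positivity)]
  have hpt : ∀ (n : ℕ) (ε : ℝ), 0 < ε → ∀ x,
      |‖(stretch 4)^[n] x - x‖ ^ 2 - ‖centre ((stretch 4)^[n] x) - centre x‖ ^ 2| ≤
        ε * ‖centre ((stretch 4)^[n] x) - centre x‖ ^ 2 + (4 ^ 2 / ε + 4 ^ 2) := by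
    intro n ε hε x
    refine abs_norm_sq_sub_norm_sq_le hε ?_
    have e : (stretch 4)^[n] x - x - (centre ((stretch 4)^[n] x) - centre x) =
      ((stretch 4)^[n] x - centre ((stretch 4)^[n] x)) - (x - centre x) := by abel
    rw [e]
    refine (norm_sub_le _ _).trans ?_
    linarith [norm_sub_centre_le x, norm_sub_centre_le ((stretch 4)^[n] x)]
  have hbi : ∀ (n : ℕ) (ε : ℝ), Integrable (fun x =>
      ε * ‖centre ((stretch 4)^[n] x) - centre x‖ ^ 2 + (4 ^ 2 / ε + 4 ^ 2)) μ := fun n ε =>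
    ((hDi n).const_mul ε).add (integrable_const _)
  have hdi : ∀ n : ℕ, Integrable (fun x =>
      ‖(stretch 4)^[n] x - x‖ ^ 2 - ‖centre ((stretch 4)^[n] x) - centre x‖ ^ 2) μ := fun n =>
    (hbi n 1).mono' ((hG n).sub (hD n)).aestronglyMeasurable
      (ae_of_all _ fun x => hpt n 1 one_pos x)
  have hGi : ∀ n : ℕ, Integrable (fun x => ‖(stretch 4)^[n] x - x‖ ^ 2) μ := fun n => by
    exact ((hdi n).add (hDi n)).congr (ae_of_all _ fun x => by simp)
  have hest : ∀ (n : ℕ) (ε : ℝ), 0 < ε →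
      |∫ x, ‖(stretch 4)^[n] x - x‖ ^ 2 ∂μ - 5 * n| ≤ ε * (5 * n) + (4 ^ 2 / ε + 4 ^ 2) := by
    intro n ε hε
    rw [← hDv n, ← integral_sub (hGi n) (hDi n)]
    refine (abs_integral_le_integral_abs).trans ?_
    refine (integral_mono (hdi n).abs (hbi n ε) (hpt n ε hε)).trans_eq ?_
    rw [integral_add ((hDi n).const_mul ε) (integrable_const _), integral_const_mul]
    simp
  have hlim : Tendsto (fun n : ℕ => 10 * (1 / √(n : ℝ))) atTop (𝓝 0) := by
    simpa using tendsto_one_div_sqrt.const_mul 10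
  rw [tendsto_iff_norm_sub_tendsto_zero]
  refine squeeze_zero' (.of_forall fun _ => norm_nonneg _) ?_ hlim
  filter_upwards [eventually_ge_atTop 1] with n hn
  have hn' : (1 : ℝ) ≤ n := by exact_mod_cast hn
  set r := √(n : ℝ) with hr
  have hrr : r * r = n := Real.mul_self_sqrt (by positivity)
  have hr1 : 1 ≤ r := Real.one_le_sqrt.2 hn'
  -- Taking ε = 1/√n makes both error terms, 5nε and 16/ε, of order √n, hence negligible after
  -- division by 4n.
  have := hest n (1 / r) (by positivity)
  rw [Real.norm_eq_abs]
  have e : (∫ x, ‖(stretch 4)^[n] x - x‖ ^ 2 ∂μ) / (4 * n) - 5 / 4 =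
      (∫ x, ‖(stretch 4)^[n] x - x‖ ^ 2 ∂μ - 5 * n) / (4 * n) := by
    field_simp
  rw [e, abs_div, abs_of_pos (by positivity : (0 : ℝ) < 4 * n), div_le_iff₀ (by positivity)]
  refine this.trans ?_
  rw [← hrr]
  field_simp
  nlinarith

/-! ### Elementary estimates for exponentials -/

open Complex in
theorem tendsto_mul_exp_sub_one_sub (x : ℝ) :
    Tendsto (fun n : ℕ => (n : ℂ) * (exp (I * ((1 / √n) * x : ℝ)) - 1 - I * ((1 / √n) * x : ℝ)))
      atTop (𝓝 (-x ^ 2 / 2 : ℝ)) := by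
  have hr := tendsto_one_div_sqrt
  have hrx : Tendsto (fun n : ℕ => |1 / √(n : ℝ) * x|) atTop (𝓝 0) := by
    simpa using (hr.mul_const x).abs
  have hb : Tendsto (fun n : ℕ => |x| ^ 3 * (1 / √(n : ℝ))) atTop (𝓝 0) := by
    simpa using hr.const_mul (|x| ^ 3)
  rw [tendsto_iff_norm_sub_tendsto_zero]
  refine squeeze_zero' (.of_forall fun _ => norm_nonneg _) ?_ hb
  filter_upwards [hrx.eventually (gt_mem_nhds one_pos), eventually_ge_atTop 1] with n hn hn1
  have hn' : (0 : ℝ) < n := by exact_mod_cast hn1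
  set r := √(n : ℝ) with hr
  have hr0 : 0 < r := Real.sqrt_pos.2 hn'
  have hrr : r * r = n := Real.mul_self_sqrt hn'.le
  have hnorm : ‖I * (((1 / r) * x : ℝ) : ℂ)‖ = |1 / r * x| := by
    rw [norm_mul, norm_I, one_mul, norm_real, Real.norm_eq_abs]
  have := exp_bound (x := I * ((1 / r) * x : ℝ)) (by rw [hnorm]; exact hn.le) (n := 3) (by norm_num)
  rw [hnorm] at this
  have e : (n : ℂ) * (exp (I * ((1 / r) * x : ℝ)) - 1 - I * ((1 / r) * x : ℝ)) - (-x ^ 2 / 2 : ℝ) =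
      n * (exp (I * ((1 / r) * x : ℝ)) -
        ∑ m ∈ Finset.range 3, (I * ((1 / r) * x : ℝ)) ^ m / m.factorial) := by
    have hrC : (r : ℂ) ≠ 0 := by exact_mod_cast hr0.ne'
    have hnC : (n : ℂ) = r * r := by rw [← ofReal_mul, hrr]; simp
    rw [hnC]
    simp [Finset.sum_range_succ]
    field_simp
    ring_nf
    simp
  rw [e, norm_mul, Complex.norm_natCast]
  refine (mul_le_mul_of_nonneg_left this hn'.le).trans ?_
  rw [← hrr, abs_mul, abs_of_pos (by positivity)]
  norm_num [Nat.factorial]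
  field_simp
  have : 0 ≤ |x| ^ 3 := by positivity
  nlinarith

-- The modulus is 2|cos((x - y)/2)|. The quadratic loss comes from cos u ≤ 1 - 2u²/π² for |u| ≤ π.
open Complex in
theorem norm_exp_add_exp_le {x y : ℝ} (hxy : |x - y| ≤ Real.pi) :
    ‖exp (I * x) + exp (I * y)‖ ≤ 2 - (x - y) ^ 2 / Real.pi ^ 2 := by
  have hpi := Real.pi_pos
  have hc := Real.cos_le_one_sub_mul_cos_sq hxy
  have hle : (x - y) ^ 2 / Real.pi ^ 2 ≤ 1 := by
    rw [div_le_one (by positivity), ← sq_abs]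
    exact pow_le_pow_left₀ (abs_nonneg _) hxy 2
  refine le_of_sq_le_sq ?_ (by linarith)
  have e : ‖exp (I * x) + exp (I * y)‖ ^ 2 = 2 + 2 * Real.cos (x - y) := by
    rw [Complex.sq_norm, normSq_apply, mul_comm I, mul_comm I]
    simp only [add_re, add_im, exp_ofReal_mul_I_re, exp_ofReal_mul_I_im, Real.cos_sub]
    nlinarith [Real.sin_sq_add_cos_sq x, Real.sin_sq_add_cos_sq y]
  rw [e]
  have : 2 / Real.pi ^ 2 * (x - y) ^ 2 = 2 * ((x - y) ^ 2 / Real.pi ^ 2) := by ring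
  nlinarith [sq_nonneg ((x - y) ^ 2 / Real.pi ^ 2)]

/-! ### Fourier transform of the walk on tiles -/

/-- The phase of a tile, in dual lattice coordinates. -/
noncomputable def phase (θ : ℝ × ℝ) (a : Tile) : ℝ :=
  θ.1 * (a.2.1 + (a.1 : ℕ) / 3) + θ.2 * (a.2.2 + (a.1 : ℕ) / 3)

theorem phase_add (θ : ℝ × ℝ) (i j : Fin 2) (z d : ℤ × ℤ) :
    phase θ (i, z + d) = phase θ (i, d) - phase θ (j, 0) + phase θ (j, z) := by
  simp [phase]; ring

theorem phase_smul (r : ℝ) (θ : ℝ × ℝ) (a : Tile) : phase (r • θ) a = r * phase θ a := by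
  simp [phase]; ring

/-- The Fourier transform of a weight on the tiles of a given type. -/
noncomputable def fourier (f : Tile → ℝ) (θ : ℝ × ℝ) (i : Fin 2) : ℂ :=
  ∑' z, (f (i, z) : ℂ) * Complex.exp (Complex.I * phase θ (i, z))

/-- The Fourier transform of the transfer from type `j` to type `i`. -/
noncomputable def symbol (θ : ℝ × ℝ) (i j : Fin 2) : ℂ :=
  (1 / 16) * ∑ d ∈ offsets i j, Complex.exp (Complex.I * (phase θ (i, d) - phase θ (j, 0) : ℝ))

/-- The evolution of real weights. -/
noncomputable def evolveReal (f : Tile → ℝ) (a : Tile) : ℝ :=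
  (1 / 16) * ∑ j, ∑ d ∈ offsets a.1 j, f (j, a.2 - d)

theorem norm_mul_exp_phase (f : Tile → ℝ) (θ : ℝ × ℝ) (a : Tile) :
    ‖(f a : ℂ) * Complex.exp (Complex.I * phase θ a)‖ = |f a| := by
  rw [norm_mul, Complex.norm_exp_I_mul_ofReal, mul_one, Complex.norm_real, Real.norm_eq_abs]

theorem summable_fourier {f : Tile → ℝ} (hf : Summable f) (θ : ℝ × ℝ) (i : Fin 2) :
    Summable fun z => (f (i, z) : ℂ) * Complex.exp (Complex.I * phase θ (i, z)) := by
  refine Summable.of_norm ?_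
  simp only [norm_mul_exp_phase]
  exact hf.abs.comp_injective (Prod.mk_right_injective i)

/-- Convolution becomes multiplication by the matrix of symbols, since phases are additive along
offsets. -/
theorem fourier_evolveReal {f : Tile → ℝ} (hf : Summable f) (θ : ℝ × ℝ) (i : Fin 2) :
    fourier (evolveReal f) θ i = ∑ j, symbol θ i j * fourier f θ j := by
  have hs : ∀ (j : Fin 2) (d : ℤ × ℤ), HasSum (fun z => (f (j, z - d) : ℂ) *
      Complex.exp (Complex.I * phase θ (i, z)))
      (Complex.exp (Complex.I * (phase θ (i, d) - phase θ (j, 0) : ℝ)) * fourier f θ j) := by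
    intro j d
    have := (summable_fourier hf θ j).hasSum.mul_left
      (Complex.exp (Complex.I * (phase θ (i, d) - phase θ (j, 0) : ℝ)))
    rw [← (Equiv.addRight d).hasSum_iff]
    refine Eq.mp (congrArg (fun g => HasSum g _ _) (funext fun z => ?_)) this
    simp only [Function.comp, Equiv.coe_addRight, add_sub_cancel_right]
    rw [phase_add θ i j z d, Complex.ofReal_add, mul_add, Complex.exp_add]
    ring
  have := (hasSum_sum fun j (_ : j ∈ Finset.univ) => hasSum_sum fun d (_ : d ∈ offsets i j) =>
    hs j d).mul_left (1 / 16)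
  rw [fourier]
  convert this.tsum_eq using 1
  · refine tsum_congr fun z => ?_
    simp only [evolveReal, Complex.ofReal_mul, Complex.ofReal_sum, Finset.sum_mul, mul_assoc]
    simp
  · simp only [symbol, mul_assoc, Finset.sum_mul, Finset.mul_sum]

/-- The displacements from the second type are the negatives of those from the first, so their
symbols are conjugate. -/
theorem symbol_one_one (θ : ℝ × ℝ) : symbol θ 1 1 = starRingEnd ℂ (symbol θ 0 0) := by
  simp [symbol, ← Complex.exp_conj, offsets, phase, map_ofNat]
  ring_nf

theorem symbol_zero_one (θ : ℝ × ℝ) : symbol θ 0 1 = starRingEnd ℂ (symbol θ 1 0) := by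
  simp [symbol, ← Complex.exp_conj, offsets, phase, map_ofNat]
  ring_nf

theorem norm_symbol_one_zero_le (θ : ℝ × ℝ) : ‖symbol θ 1 0‖ ≤ 6 / 16 := by
  rw [symbol, norm_mul]
  have := norm_sum_le (offsets 1 0) fun d =>
    Complex.exp (Complex.I * (phase θ (1, d) - phase θ (0, 0) : ℝ))
  simp only [Complex.norm_exp_I_mul_ofReal, Finset.sum_const] at this
  rw [show (offsets 1 0).card = 6 by decide] at this
  norm_num at this ⊢
  linarith

/-- Of the ten unit terms, two disjoint pairs differ by the basis vectors (1, 0) and (0, 1). Each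
pair loses θᵢ²/π², and the other six terms are bounded by 1. -/
theorem norm_symbol_zero_zero_le {θ : ℝ × ℝ} (h1 : |θ.1| ≤ Real.pi) (h2 : |θ.2| ≤ Real.pi) :
    ‖symbol θ 0 0‖ ≤ 10 / 16 - (θ.1 ^ 2 + θ.2 ^ 2) / (16 * Real.pi ^ 2) := by
  have hsplit : offsets 0 0 = {(-1, 0), (0, 0)} ∪ ({(-1, 1), (-1, 2)} ∪
      {(-1, -1), (0, -1), (0, 1), (1, -1), (1, 0), (2, -1)}) := by decide
  rw [symbol, norm_mul, hsplit, Finset.sum_union (by decide), Finset.sum_union (by decide),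
    Finset.sum_pair (by decide), Finset.sum_pair (by decide)]
  have k1 := norm_exp_add_exp_le (x := phase θ (0, (-1, 0)) - phase θ (0, 0))
    (y := phase θ (0, (0, 0)) - phase θ (0, 0)) (by simpa [phase] using h1)
  have k2 := norm_exp_add_exp_le (x := phase θ (0, (-1, 1)) - phase θ (0, 0))
    (y := phase θ (0, (-1, 2)) - phase θ (0, 0)) (by
      convert h2 using 1; rw [← abs_neg]; congr 1; simp [phase]; ring)
  have k3 := norm_sum_le {(-1, -1), (0, -1), (0, 1), (1, -1), (1, 0), (2, -1)} fun d =>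
    Complex.exp (Complex.I * (phase θ (0, d) - phase θ (0, 0) : ℝ))
  simp only [Complex.norm_exp_I_mul_ofReal, Finset.sum_const] at k3
  rw [show (({(-1, -1), (0, -1), (0, 1), (1, -1), (1, 0), (2, -1)} : Finset (ℤ × ℤ))).card = 6 by
    decide] at k3
  have e1 : (phase θ (0, (-1, 0)) - phase θ (0, 0) - (phase θ (0, (0, 0)) - phase θ (0, 0))) ^ 2 =
      θ.1 ^ 2 := by simp [phase]
  have e2 : (phase θ (0, (-1, 1)) - phase θ (0, 0) - (phase θ (0, (-1, 2)) - phase θ (0, 0))) ^ 2 =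
      θ.2 ^ 2 := by simp [phase]; ring
  rw [e1] at k1
  rw [e2] at k2
  have hn : ‖(1 / 16 : ℂ)‖ = 1 / 16 := by norm_num
  rw [hn]
  have := (norm_add_le _ _).trans (add_le_add k1 ((norm_add_le _ _).trans (add_le_add k2 k3)))
  refine (mul_le_mul_of_nonneg_left this (by norm_num)).trans_eq ?_
  field_simp
  norm_num
  ring

theorem norm_symbol_add_le {θ : ℝ × ℝ} (h1 : |θ.1| ≤ Real.pi) (h2 : |θ.2| ≤ Real.pi) :
    ‖symbol θ 0 0‖ + ‖symbol θ 1 0‖ ≤ Real.exp (-((θ.1 ^ 2 + θ.2 ^ 2) / (16 * Real.pi ^ 2))) := by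
  have := Real.add_one_le_exp (-((θ.1 ^ 2 + θ.2 ^ 2) / (16 * Real.pi ^ 2)))
  linarith [norm_symbol_zero_zero_le h1 h2, norm_symbol_one_zero_le θ]

theorem norm_symbol_zero_zero_add_le_one (θ : ℝ × ℝ) : ‖symbol θ 0 0‖ + ‖symbol θ 1 0‖ ≤ 1 := by
  have : ‖symbol θ 0 0‖ ≤ 10 / 16 := by
    rw [symbol, norm_mul]
    have := norm_sum_le (offsets 0 0) fun d =>
      Complex.exp (Complex.I * (phase θ (0, d) - phase θ (0, 0) : ℝ))
    simp only [Complex.norm_exp_I_mul_ofReal, Finset.sum_const] at this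
    rw [show (offsets 0 0).card = 10 by decide] at this
    norm_num at this ⊢
    linarith
  linarith [norm_symbol_one_zero_le θ]

/-- The quadratic form of the limiting Gaussian. -/
noncomputable def quad (θ : ℝ × ℝ) : ℝ := 5 / 12 * (θ.1 ^ 2 - θ.1 * θ.2 + θ.2 ^ 2)

/-- Second-order expansion of the characteristic function of one jump from the first type: the
phases sum to zero, and half their mean square is `quad τ`. -/
theorem tendsto_mul_symbol_sub_one (τ : ℝ × ℝ) :
    Tendsto (fun n : ℕ => (n : ℂ) * (symbol ((1 / √n : ℝ) • τ) 0 0 + symbol ((1 / √n : ℝ) • τ) 1 0 - 1))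
      atTop (𝓝 (-quad τ : ℝ)) := by
  have key := (tendsto_finsetSum Finset.univ fun i _ => tendsto_finsetSum (offsets i 0) fun d _ =>
    tendsto_mul_exp_sub_one_sub (phase τ (i, d) - phase τ (0, 0))).const_mul (1 / 16 : ℂ)
  convert key using 1
  · ext n
    have hph : ∑ i, ∑ d ∈ offsets i 0, ((phase τ (i, d) - phase τ (0, 0) : ℝ) : ℂ) = 0 := by
      simp [Fin.sum_univ_two, offsets, phase]
      ring
    have hcard : ∑ i, ∑ d ∈ offsets i 0, (1 : ℂ) = 16 := by
      simp [Fin.sum_univ_two, show (offsets 0 0).card = 10 by decide,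
        show (offsets 1 0).card = 6 by decide]
      norm_num
    simp only [symbol, phase_smul, ← mul_sub, ← Finset.mul_sum, Finset.sum_sub_distrib,
      Complex.ofReal_mul (1 / √(n : ℝ))]
    rw [hcard, hph, Fin.sum_univ_two]
    ring
  · congr 1
    simp [Fin.sum_univ_two, offsets, quad, phase]
    ring

theorem tendsto_symbol (τ : ℝ × ℝ) (i : Fin 2) :
    Tendsto (fun n : ℕ => symbol ((1 / √n : ℝ) • τ) i 0) atTop (𝓝 (![10 / 16, 6 / 16] i)) := by
  have hr := tendsto_one_div_sqrt
  have hc : Continuous fun r : ℝ => symbol (r • τ) i 0 := by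
    simp only [symbol, phase_smul]
    fun_prop
  have := (hc.tendsto 0).comp hr
  simp only [Function.comp_def] at this
  convert this using 2
  fin_cases i
  · simp [symbol, phase, show (offsets 0 0).card = 10 by decide]; norm_num
  · simp [symbol, phase, show (offsets 1 0).card = 6 by decide]; norm_num

theorem norm_fourier_add_le {f : Tile → ℝ} (hf0 : ∀ a, 0 ≤ f a) (hf : HasSum f 1) (θ : ℝ × ℝ) :
    ‖fourier f θ 0‖ + ‖fourier f θ 1‖ ≤ 1 := by
  have hsum := hf.summable.tsum_prod
  rw [hf.tsum_eq, tsum_fintype, Fin.sum_univ_two] at hsum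
  have key : ∀ i, ‖fourier f θ i‖ ≤ ∑' z, f (i, z) := by
    intro i
    have hs := (summable_fourier hf.summable θ i).norm
    refine (norm_tsum_le_tsum_norm hs).trans_eq (tsum_congr fun z => ?_)
    rw [norm_mul_exp_phase, abs_of_nonneg (hf0 _)]
  linarith [key 0, key 1]

theorem continuous_fourier {f : Tile → ℝ} (hf : Summable f) (i : Fin 2) :
    Continuous fun θ => fourier f θ i := by
  refine continuous_tsum (u := fun z => |f (i, z)|) (fun z => ?_)
    (hf.abs.comp_injective (Prod.mk_right_injective i)) fun z θ => (norm_mul_exp_phase f θ _).le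
  simp only [phase]
  fun_prop

/-- For the sum of the two components: each step perturbs multiplication by `A` by at most |B|, and
these errors are not amplified. -/
theorem norm_sub_pow_mul_le {S D : ℕ → ℂ} {A B : ℝ} (hA : |A| ≤ 1) (hD : ∀ k, ‖D k‖ ≤ 1)
    (hS : ∀ k, S (k + 1) = A * S k + Complex.I * B * D k) (n : ℕ) :
    ‖S n - A ^ n * S 0‖ ≤ n * |B| := by
  induction n with
  | zero => simp
  | succ n ih =>
    have e : S (n + 1) - A ^ (n + 1) * S 0 =
        A * (S n - A ^ n * S 0) + Complex.I * B * D n := by rw [hS]; ring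
    rw [e]
    refine (norm_add_le _ _).trans ?_
    rw [norm_mul, norm_mul, norm_mul, Complex.norm_I, one_mul, Complex.norm_real, Complex.norm_real,
      Real.norm_eq_abs, Real.norm_eq_abs]
    push_cast
    have := mul_le_mul hA ih (norm_nonneg _) zero_le_one
    have := mul_le_mul_of_nonneg_left (hD n) (abs_nonneg B)
    linarith

/-- For the difference of the two components: the contraction forgets the initial value, and the
forcing |B| sums geometrically to at most 2|B|. -/
theorem norm_le_half_pow_add {S D : ℕ → ℂ} {A B : ℝ} (hA : |A| ≤ 1 / 2) (hS : ∀ k, ‖S k‖ ≤ 1)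
    (hD0 : ‖D 0‖ ≤ 1) (hD : ∀ k, D (k + 1) = A * D k + Complex.I * B * S k) (n : ℕ) :
    ‖D n‖ ≤ (1 / 2) ^ n + 2 * |B| := by
  induction n with
  | zero => simp; linarith [abs_nonneg B]
  | succ n ih =>
    rw [hD]
    refine (norm_add_le _ _).trans ?_
    rw [norm_mul, norm_mul, norm_mul, Complex.norm_I, one_mul, Complex.norm_real, Complex.norm_real,
      Real.norm_eq_abs, Real.norm_eq_abs, pow_succ]
    have := mul_le_mul hA ih (norm_nonneg _) (by norm_num)
    have := mul_le_mul_of_nonneg_left (hS n) (abs_nonneg B)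
    linarith

/-- Both columns of the symbol matrix have ℓ¹ norm |a| + |b|, which therefore bounds the growth of
the ℓ¹ norm of the pair. -/
theorem norm_fourier_add_le_pow {m : ℕ → Tile → ℝ} (hm0 : ∀ n a, 0 ≤ m n a)
    (hm : ∀ n, HasSum (m n) 1) (hrec : ∀ n, m (n + 1) = evolveReal (m n))
    (θ : ℝ × ℝ) (n : ℕ) :
    ‖fourier (m n) θ 0‖ + ‖fourier (m n) θ 1‖ ≤ (‖symbol θ 0 0‖ + ‖symbol θ 1 0‖) ^ n := by
  induction n with
  | zero => simpa using norm_fourier_add_le (hm0 0) (hm 0) θ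
  | succ n ih =>
    rw [hrec, fourier_evolveReal (hm n).summable, fourier_evolveReal (hm n).summable,
      Fin.sum_univ_two, Fin.sum_univ_two, symbol_one_one, symbol_zero_one]
    have h1 := norm_add_le (symbol θ 0 0 * fourier (m n) θ 0)
      (starRingEnd ℂ (symbol θ 1 0) * fourier (m n) θ 1)
    have h2 := norm_add_le (symbol θ 1 0 * fourier (m n) θ 0)
      (starRingEnd ℂ (symbol θ 0 0) * fourier (m n) θ 1)
    simp only [norm_mul, RCLike.norm_conj] at h1 h2
    rw [pow_succ']
    have := mul_le_mul_of_nonneg_left ih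
      (add_nonneg (norm_nonneg (symbol θ 0 0)) (norm_nonneg (symbol θ 1 0)))
    linarith

theorem tendsto_fourier {m : ℕ → Tile → ℝ} (hm0 : ∀ n a, 0 ≤ m n a)
    (hm : ∀ n, HasSum (m n) 1) (hrec : ∀ n, m (n + 1) = evolveReal (m n))
    (τ : ℝ × ℝ) (i : Fin 2) :
    Tendsto (fun n : ℕ => fourier (m n) ((1 / √n : ℝ) • τ) i) atTop
      (𝓝 ((1 / 2 * Real.exp (-quad τ) : ℝ) : ℂ)) := by
  let θ : ℕ → ℝ × ℝ := fun n => (1 / √n : ℝ) • τ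
  let a : ℕ → ℂ := fun n => symbol (θ n) 0 0
  let b : ℕ → ℂ := fun n => symbol (θ n) 1 0
  let S : ℕ → ℕ → ℂ := fun n k => fourier (m k) (θ n) 0 + fourier (m k) (θ n) 1
  let D : ℕ → ℕ → ℂ := fun n k => fourier (m k) (θ n) 0 - fourier (m k) (θ n) 1
  have hle := fun n k => norm_fourier_add_le (hm0 k) (hm k) (θ n)
  have hS1 : ∀ n k, ‖S n k‖ ≤ 1 := fun n k => (norm_add_le _ _).trans (hle n k)
  have hD1 : ∀ n k, ‖D n k‖ ≤ 1 := fun n k => (norm_sub_le _ _).trans (hle n k)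
  have hstep : ∀ n k, fourier (m (k + 1)) (θ n) 0 =
      a n * fourier (m k) (θ n) 0 + starRingEnd ℂ (b n) * fourier (m k) (θ n) 1 ∧
      fourier (m (k + 1)) (θ n) 1 =
      b n * fourier (m k) (θ n) 0 + starRingEnd ℂ (a n) * fourier (m k) (θ n) 1 := by
    intro n k
    rw [hrec, fourier_evolveReal (hm k).summable, fourier_evolveReal (hm k).summable,
      Fin.sum_univ_two, Fin.sum_univ_two, symbol_one_one, symbol_zero_one]
    exact ⟨rfl, rfl⟩
  have hS : ∀ n k, S n (k + 1) = ((a n + b n).re : ℝ) * S n k +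
      Complex.I * ((a n + b n).im : ℝ) * D n k := by
    intro n k
    simp only [S, D, (hstep n k).1, (hstep n k).2]
    generalize fourier (m k) (θ n) 0 = x
    generalize fourier (m k) (θ n) 1 = y
    apply Complex.ext <;> simp <;> ring
  have hD : ∀ n k, D n (k + 1) = ((a n - b n).re : ℝ) * D n k +
      Complex.I * ((a n - b n).im : ℝ) * S n k := by
    intro n k
    simp only [S, D, (hstep n k).1, (hstep n k).2]
    generalize fourier (m k) (θ n) 0 = x
    generalize fourier (m k) (θ n) 1 = y
    apply Complex.ext <;> simp <;> ring
  have hab := tendsto_mul_symbol_sub_one τ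
  have hre : Tendsto (fun n : ℕ => (n : ℝ) * ((a n + b n).re - 1)) atTop (𝓝 (-quad τ)) := by
    have := (Complex.continuous_re.tendsto _).comp hab
    simpa [Function.comp_def, a, b, θ] using this
  -- The limit -`quad τ` is real, so the coupling of S to D, accumulated over n steps, tends to
  -- zero.
  have him : Tendsto (fun n : ℕ => (n : ℝ) * (a n + b n).im) atTop (𝓝 0) := by
    have := (Complex.continuous_im.tendsto _).comp hab
    simpa [Function.comp_def, a, b, θ] using this
  have hpow : Tendsto (fun n : ℕ => (a n + b n).re ^ n) atTop (𝓝 (Real.exp (-quad τ))) := by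
    simpa using Real.tendsto_one_add_pow_exp_of_tendsto hre
  have hA : ∀ n, |(a n + b n).re| ≤ 1 := fun n =>
    (Complex.abs_re_le_norm _).trans ((norm_add_le _ _).trans (norm_symbol_zero_zero_add_le_one _))
  -- The limit is 10/16 - 6/16, the second eigenvalue of the type-switching chain; being below 1/2,
  -- it makes the types equidistribute.
  have hamb : Tendsto (fun n => a n - b n) atTop (𝓝 (1 / 4)) := by
    have := (tendsto_symbol τ 0).sub (tendsto_symbol τ 1)
    convert this using 2
    norm_num
  have hS0 : Tendsto (fun n => S n 0) atTop (𝓝 1) := by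
    have hc := (continuous_fourier (hm 0).summable 0).add (continuous_fourier (hm 0).summable 1)
    have h0 : fourier (m 0) 0 0 + fourier (m 0) 0 1 = 1 := by
      have hsum := (hm 0).summable.tsum_prod
      rw [(hm 0).tsum_eq, tsum_fintype, Fin.sum_univ_two] at hsum
      simp only [fourier, phase]
      simp only [Prod.fst_zero, Prod.snd_zero, zero_mul, add_zero, Complex.ofReal_zero, mul_zero,
        Complex.exp_zero, mul_one, ← Complex.ofReal_tsum]
      exact_mod_cast hsum.symm
    have hθ : Tendsto θ atTop (𝓝 0) := by
      simpa [θ] using tendsto_one_div_sqrt.smul_const τ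
    have := (hc.tendsto 0).comp hθ
    simp only [Pi.add_apply, h0] at this
    exact this
  have hSn : Tendsto (fun n => S n n) atTop (𝓝 (Real.exp (-quad τ) : ℝ)) := by
    have h1 : Tendsto (fun n => S n n - ((a n + b n).re : ℝ) ^ n * S n 0) atTop (𝓝 0) := by
      refine squeeze_zero_norm (fun n => norm_sub_pow_mul_le (hA n) (hD1 n) (hS n) n) ?_
      simpa [abs_mul] using him.abs
    have h2 : Tendsto (fun n => (((a n + b n).re : ℝ) : ℂ) ^ n * S n 0) atTop
        (𝓝 ((Real.exp (-quad τ) : ℝ) * 1)) := by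
      refine Tendsto.mul ?_ hS0
      have := (Complex.continuous_ofReal.tendsto _).comp hpow
      simpa only [Function.comp_def, Complex.ofReal_pow] using this
    simpa using h1.add h2
  have hDn : Tendsto (fun n => D n n) atTop (𝓝 0) := by
    have hre' : Tendsto (fun n => |(a n - b n).re|) atTop (𝓝 (1 / 4)) := by
      have := ((Complex.continuous_re.tendsto _).comp hamb).abs
      have e : |(1 / 4 : ℂ).re| = 1 / 4 := by norm_num
      rwa [e] at this
    have him' : Tendsto (fun n => |(a n - b n).im|) atTop (𝓝 0) := by
      have := ((Complex.continuous_im.tendsto _).comp hamb).abs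
      have e : |(1 / 4 : ℂ).im| = 0 := by norm_num
      rwa [e] at this
    have hb : Tendsto (fun n : ℕ => (1 / 2 : ℝ) ^ n + 2 * |(a n - b n).im|) atTop (𝓝 0) := by
      simpa using (tendsto_pow_atTop_nhds_zero_of_lt_one (r := (1 / 2 : ℝ)) (by norm_num)
        (by norm_num)).add (him'.const_mul 2)
    refine squeeze_zero_norm' ?_ hb
    filter_upwards [hre'.eventually (gt_mem_nhds (by norm_num : (1 / 4 : ℝ) < 1 / 2))] with n hn
    exact norm_le_half_pow_add hn.le (hS1 n) (hD1 n 0) (hD n) n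
  have h0 := (hSn.add hDn).const_mul (1 / 2 : ℂ)
  have h1 := (hSn.sub hDn).const_mul (1 / 2 : ℂ)
  fin_cases i
  · convert h0 using 1
    · ext n; simp only [S, D, θ, Fin.zero_eta]; ring
    · simp
  · convert h1 using 1
    · ext n; simp only [S, D, θ, Fin.mk_one]; ring
    · simp

/-! ### Fourier inversion and the Gaussian integral -/

/-- A fundamental domain of the dual lattice. -/
def box : Set (ℝ × ℝ) := Set.Ioc (-Real.pi) Real.pi ×ˢ Set.Ioc (-Real.pi) Real.pi

theorem measurableSet_box : MeasurableSet box := measurableSet_Ioc.prod measurableSet_Ioc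

theorem integral_exp_int (k : ℤ) :
    ∫ x in Set.Ioc (-Real.pi) Real.pi, Complex.exp (Complex.I * (x * k : ℝ)) =
      if k = 0 then 2 * (Real.pi : ℂ) else 0 := by
  rw [← intervalIntegral.integral_of_le (by linarith [Real.pi_pos])]
  split_ifs with hk
  · subst hk
    simp
    ring
  · have hc : Complex.I * (k : ℂ) ≠ 0 := mul_ne_zero Complex.I_ne_zero (by exact_mod_cast hk)
    have := integral_exp_mul_complex (a := -Real.pi) (b := Real.pi) hc
    have e : ∀ x : ℝ, Complex.I * (x * k : ℝ) = Complex.I * k * x := fun x => by push_cast; ring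
    simp only [e, this]
    rw [div_eq_zero_iff]
    left
    rw [sub_eq_zero, Complex.exp_eq_exp_iff_exists_int]
    exact ⟨k, by push_cast; ring⟩

/-- Orthogonality of characters, integrated termwise by absolute summability. The fractional parts
of the phases cancel because both tiles have type `i`. -/
theorem setIntegral_fourier_mul_exp {f : Tile → ℝ} (hf : Summable f) (i : Fin 2) (z : ℤ × ℤ) :
    ∫ θ in box, fourier f θ i * Complex.exp (-(Complex.I * phase θ (i, z))) =
      (2 * Real.pi) ^ 2 * f (i, z) := by
  have hfin : IsFiniteMeasure (volume.restrict box) := by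
    refine isFiniteMeasure_restrict.2 ?_
    rw [box, Measure.volume_eq_prod, Measure.prod_prod]
    simp [ENNReal.mul_eq_top]
  have hcont : ∀ w, Continuous fun θ => (f (i, w) : ℂ) *
      Complex.exp (Complex.I * phase θ (i, w)) * Complex.exp (-(Complex.I * phase θ (i, z))) := by
    intro w
    simp only [phase]
    fun_prop
  have hnorm : ∀ w θ, ‖(f (i, w) : ℂ) * Complex.exp (Complex.I * phase θ (i, w)) *
      Complex.exp (-(Complex.I * phase θ (i, z)))‖ = |f (i, w)| := by
    intro w θ
    rw [norm_mul, norm_mul_exp_phase, ← mul_neg, ← Complex.ofReal_neg,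
      Complex.norm_exp_I_mul_ofReal, mul_one]
  have := hasSum_integral_of_summable_integral_norm (μ := volume.restrict box)
    (F := fun w θ => (f (i, w) : ℂ) * Complex.exp (Complex.I * phase θ (i, w)) *
      Complex.exp (-(Complex.I * phase θ (i, z))))
    (fun w => Integrable.of_bound (hcont w).aestronglyMeasurable |f (i, w)|
      (ae_of_all _ fun θ => (hnorm w θ).le)) (by
      simp only [hnorm, integral_const, smul_eq_mul]
      exact (hf.abs.comp_injective (Prod.mk_right_injective i)).mul_left _)
  simp only [tsum_mul_right] at this
  refine (HasSum.unique this ?_ :)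
  have hval : ∀ w : ℤ × ℤ, ∫ θ in box, (f (i, w) : ℂ) * Complex.exp (Complex.I * phase θ (i, w)) *
      Complex.exp (-(Complex.I * phase θ (i, z))) =
      if w = z then (2 * Real.pi) ^ 2 * (f (i, z) : ℂ) else 0 := by
    intro w
    have e : ∀ θ : ℝ × ℝ, (f (i, w) : ℂ) * Complex.exp (Complex.I * phase θ (i, w)) *
        Complex.exp (-(Complex.I * phase θ (i, z))) =
        f (i, w) * (Complex.exp (Complex.I * (θ.1 * (w.1 - z.1 : ℤ) : ℝ)) *
          Complex.exp (Complex.I * (θ.2 * (w.2 - z.2 : ℤ) : ℝ))) := by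
      intro θ
      rw [mul_assoc, ← Complex.exp_add, ← Complex.exp_add]
      congr 2
      simp [phase]
      ring
    simp only [e, integral_const_mul]
    rw [box, Measure.volume_eq_prod, setIntegral_prod_mul
      (fun x : ℝ => Complex.exp (Complex.I * (x * (w.1 - z.1 : ℤ) : ℝ)))
      (fun x : ℝ => Complex.exp (Complex.I * (x * (w.2 - z.2 : ℤ) : ℝ))),
      integral_exp_int, integral_exp_int]
    simp only [sub_eq_zero]
    by_cases hw : w = z
    · subst hw
      simp
      ring
    · rw [if_neg hw]
      have : ¬ (w.1 = z.1 ∧ w.2 = z.2) := fun q => hw (Prod.ext q.1 q.2)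
      by_cases h1 : w.1 = z.1
      · rw [if_neg fun h2 => this ⟨h1, h2⟩]; simp
      · rw [if_neg h1]; simp
  simp only [hval]
  exact hasSum_ite_eq z _

theorem continuous_quad : Continuous quad := by
  unfold quad
  fun_prop

theorem integrable_exp_neg_mul_sq_add_sq {b : ℝ} (hb : 0 < b) :
    Integrable fun τ : ℝ × ℝ => Real.exp (-(b * (τ.1 ^ 2 + τ.2 ^ 2))) := by
  have := (integrable_exp_neg_mul_sq hb).mul_prod (integrable_exp_neg_mul_sq hb)
  rw [← Measure.volume_eq_prod] at this
  refine this.congr (ae_of_all _ fun τ => ?_)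
  simp only
  rw [← Real.exp_add]
  congr 1
  ring

theorem integrable_exp_neg_quad : Integrable fun τ => Real.exp (-quad τ) := by
  refine (integrable_exp_neg_mul_sq_add_sq (b := 5 / 24) (by norm_num)).mono'
    (by have := continuous_quad; fun_prop) (ae_of_all _ fun τ => ?_)
  rw [Real.norm_eq_abs, Real.abs_exp, Real.exp_le_exp]
  unfold quad
  nlinarith [sq_nonneg (τ.1 - τ.2)]

/-- Two successive one-dimensional Gaussian integrals. Integrating out t leaves the coefficient 5/12
· (1 - 1/4) = 5/16 of s². -/
theorem integral_exp_neg_quad_mul_exp (x y : ℝ) :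
    ∫ τ : ℝ × ℝ, (Real.exp (-quad τ) : ℂ) * Complex.exp (-(Complex.I * (τ.1 * x + τ.2 * y : ℝ))) =
      ((24 * h * Real.pi / 5 * Real.exp (-(4 / 5 * (x ^ 2 + x * y + y ^ 2))) : ℝ) : ℂ) := by
  have hp := h_pos
  have hint : Integrable fun τ : ℝ × ℝ =>
      (Real.exp (-quad τ) : ℂ) * Complex.exp (-(Complex.I * (τ.1 * x + τ.2 * y : ℝ))) := by
    refine integrable_exp_neg_quad.ofReal.mul_bdd (c := 1)
      (by fun_prop) (ae_of_all _ fun τ => ?_)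
    rw [← mul_neg, ← Complex.ofReal_neg, Complex.norm_exp_I_mul_ofReal]
  have hsqrt : ∀ b : ℝ, 0 < b → ((Real.pi : ℂ) / -(-(b : ℂ))) ^ (1 / 2 : ℂ) = (√(Real.pi / b) : ℝ) := by
    intro b hb
    have hpi := Real.pi_pos
    rw [Real.sqrt_eq_rpow, Complex.ofReal_cpow (by positivity)]
    simp
  have hin : ∀ s : ℝ, ∫ t : ℝ, (Real.exp (-quad (s, t)) : ℂ) *
      Complex.exp (-(Complex.I * (s * x + t * y : ℝ))) =
      (√(Real.pi / (5 / 12)) : ℝ) * Complex.exp (-((5 / 16 : ℝ) : ℂ) * s ^ 2 +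
        (-(Complex.I * (x + y / 2))) * s + (-(3 / 5) * y ^ 2)) := by
    intro s
    have hq := integral_cexp_quadratic (b := -((5 / 12 : ℝ) : ℂ)) (by norm_num)
      (5 / 12 * s - Complex.I * y) (-(5 / 12) * s ^ 2 - Complex.I * s * x)
    rw [hsqrt _ (by norm_num)] at hq
    convert hq using 1
    · congr 1
      ext t
      rw [Complex.ofReal_exp, ← Complex.exp_add]
      congr 1
      simp [quad]
      ring
    · congr 2
      push_cast
      field_simp
      ring_nf
      simp
      ring
  rw [Measure.volume_eq_prod] at hint ⊢
  rw [integral_prod _ hint]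
  simp only [hin, integral_const_mul]
  rw [integral_cexp_quadratic (by norm_num), hsqrt _ (by norm_num), ← mul_assoc, ← Complex.ofReal_mul,
    ← Real.sqrt_mul (by positivity)]
  have hc : √(Real.pi / (5 / 12) * (Real.pi / (5 / 16))) = 24 * h * Real.pi / 5 := by
    have hpi := Real.pi_pos
    rw [Real.sqrt_eq_iff_mul_self_eq (by positivity) (by positivity)]
    linear_combination (-(192 / 25) * Real.pi ^ 2) * three_h_sq
  rw [hc, Complex.ofReal_mul _ (Real.exp _), Complex.ofReal_exp]
  congr 2
  push_cast
  field_simp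
  ring_nf
  simp
  ring

/-! ### The local limit theorem -/

/-- The squared length in lattice coordinates, up to the factor `4`. -/
noncomputable def latticeNormSq (a : Tile) : ℝ :=
  (a.2.1 + (a.1 : ℕ) / 3 : ℝ) ^ 2 +
    (a.2.1 + (a.1 : ℕ) / 3 : ℝ) * (a.2.2 + (a.1 : ℕ) / 3) + (a.2.2 + (a.1 : ℕ) / 3 : ℝ) ^ 2

/-- Fourier inversion after the substitution θ = τ/√n, whose Jacobian in dimension two produces the
factor n. -/
theorem natCast_mul_eq_integral {f : Tile → ℝ} (hf : Summable f) (a : Tile) {n : ℕ} (hn : 1 ≤ n) :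
    ((2 * Real.pi) ^ 2 * (n * f a) : ℂ) =
      ∫ τ : ℝ × ℝ, box.indicator (fun θ => fourier f θ a.1) ((1 / √n : ℝ) • τ) *
        Complex.exp (-(Complex.I * (1 / √n * phase τ a : ℝ))) := by
  have hn' : (0 : ℝ) < n := by exact_mod_cast hn
  have key := Measure.integral_comp_smul (volume : Measure (ℝ × ℝ))
    (fun θ => box.indicator (fun θ => fourier f θ a.1) θ *
      Complex.exp (-(Complex.I * phase θ a))) (1 / √n)
  have e2 : |((1 / √(n : ℝ)) ^ Module.finrank ℝ (ℝ × ℝ))⁻¹| = n := by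
    rw [Module.finrank_prod, Module.finrank_self]
    norm_num [Real.sq_sqrt hn'.le]
  rw [e2] at key
  simp only [phase_smul] at key
  rw [key]
  have e3 : (fun θ => box.indicator (fun θ => fourier f θ a.1) θ *
      Complex.exp (-(Complex.I * phase θ a))) =
      box.indicator fun θ => fourier f θ a.1 * Complex.exp (-(Complex.I * phase θ a)) := by
    ext θ
    by_cases hθ : θ ∈ box <;> simp [hθ]
  rw [e3, integral_indicator measurableSet_box, setIntegral_fourier_mul_exp hf a.1 a.2]
  rw [Complex.real_smul]
  push_cast
  ring

/-- The local limit theorem for the weights of the tiles. -/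
theorem tendstoUniformly_weights {m : ℕ → Tile → ℝ} (hm0 : ∀ n a, 0 ≤ m n a)
    (hm : ∀ n, HasSum (m n) 1) (hrec : ∀ n, m (n + 1) = evolveReal (m n)) :
    TendstoUniformly (fun (n : ℕ) a => n * m n a -
      3 * h / (5 * Real.pi) * Real.exp (-(4 / 5 * (latticeNormSq a / n)))) 0 atTop := by
  have hpi := Real.pi_pos
  let g : ℝ × ℝ → ℂ := fun τ => ((1 / 2 * Real.exp (-quad τ) : ℝ) : ℂ)
  let F : ℕ → Fin 2 → ℝ × ℝ → ℂ := fun n i τ =>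
    box.indicator (fun θ => fourier (m n) θ i) ((1 / √n : ℝ) • τ)
  have hgi : Integrable g := (integrable_exp_neg_quad.const_mul (1 / 2)).ofReal
  have hFm : ∀ n i, AEStronglyMeasurable (F n i) volume := fun n i => by
    have h1 : Measurable (box.indicator fun θ => fourier (m n) θ i) :=
      (continuous_fourier (hm n).summable i).measurable.indicator measurableSet_box
    exact (h1.comp (by fun_prop)).aestronglyMeasurable
  let c : ℝ := 1 / (16 * Real.pi ^ 2)
  have hc : 0 < c := by positivity
  -- An integrable majorant free of n: the n-th power of the one-step bound at τ/√n is a fixed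
  -- Gaussian in τ. The case n = 0 is excluded because 1/√0 = 0 makes `F 0` constant.
  have hFb : ∀ n, 1 ≤ n → ∀ i τ, ‖F n i τ‖ ≤ Real.exp (-(c * (τ.1 ^ 2 + τ.2 ^ 2))) := by
    intro n hn i τ
    have hn' : (0 : ℝ) < n := by exact_mod_cast hn
    have hs : 0 < √(n : ℝ) := Real.sqrt_pos.2 hn'
    by_cases hθ : (1 / √n : ℝ) • τ ∈ box
    · simp only [F, Set.indicator_of_mem hθ]
      have hb := hθ
      simp only [box, Set.mem_prod, Set.mem_Ioc] at hb
      have h1 : |((1 / √n : ℝ) • τ).1| ≤ Real.pi := abs_le.2 ⟨hb.1.1.le, hb.1.2⟩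
      have h2 : |((1 / √n : ℝ) • τ).2| ≤ Real.pi := abs_le.2 ⟨hb.2.1.le, hb.2.2⟩
      have h3 := norm_fourier_add_le_pow hm0 hm hrec ((1 / √n : ℝ) • τ) n
      have h4 := pow_le_pow_left₀ (by positivity) (norm_symbol_add_le h1 h2) n
      rw [← Real.exp_nat_mul] at h4
      have h5 : ‖fourier (m n) ((1 / √n : ℝ) • τ) i‖ ≤
          ‖fourier (m n) ((1 / √n : ℝ) • τ) 0‖ + ‖fourier (m n) ((1 / √n : ℝ) • τ) 1‖ := by
        fin_cases i
        · exact le_add_of_nonneg_right (norm_nonneg _)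
        · exact le_add_of_nonneg_left (norm_nonneg _)
      refine (h5.trans (h3.trans h4)).trans_eq ?_
      congr 1
      simp only [Prod.smul_fst, Prod.smul_snd, smul_eq_mul, mul_pow, div_pow, Real.sq_sqrt hn'.le, c]
      field_simp
    · simp only [F, Set.indicator_of_notMem hθ, norm_zero]
      positivity
  have hFi : ∀ n, 1 ≤ n → ∀ i, Integrable (F n i) := fun n hn i =>
    (integrable_exp_neg_mul_sq_add_sq hc).mono' (hFm n i) (ae_of_all _ (hFb n hn i))
  have hlim : ∀ i, Tendsto (fun n => ∫ τ, ‖F n i τ - g τ‖) atTop (𝓝 0) := by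
    intro i
    have := tendsto_integral_filter_of_dominated_convergence (μ := volume) (l := atTop)
      (F := fun n τ => ‖F n i τ - g τ‖) (f := fun _ => (0 : ℝ))
      (fun τ : ℝ × ℝ => Real.exp (-(c * (τ.1 ^ 2 + τ.2 ^ 2))) + ‖g τ‖)
      (.of_forall fun n => ((hFm n i).sub hgi.aestronglyMeasurable).norm) ?_
      ((integrable_exp_neg_mul_sq_add_sq hc).add hgi.norm) ?_
    · simpa using this
    · filter_upwards [eventually_ge_atTop 1] with n hn
      refine ae_of_all _ fun τ => ?_
      rw [norm_norm]
      exact (norm_sub_le _ _).trans (add_le_add_left (hFb n hn i τ) _)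
    · refine ae_of_all _ fun τ => ?_
      rw [← norm_zero (E := ℂ), ← sub_self (g τ)]
      refine Tendsto.norm (Tendsto.sub ?_ tendsto_const_nhds)
      refine (tendsto_fourier hm0 hm hrec τ i).congr' ?_
      have hθ : Tendsto (fun n : ℕ => (1 / √n : ℝ) • τ) atTop (𝓝 0) := by
        simpa using tendsto_one_div_sqrt.smul_const τ
      have hbox : box ∈ 𝓝 (0 : ℝ × ℝ) :=
        prod_mem_nhds (Ioc_mem_nhds (by simpa using hpi) (by simpa using hpi))
          (Ioc_mem_nhds (by simpa using hpi) (by simpa using hpi))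
      filter_upwards [hθ hbox] with n hn
      simp only [F]
      rw [Set.indicator_of_mem (Set.mem_preimage.1 hn)]
  -- Uniformity in the tile: `a` enters the inversion integrals through its type and a factor of
  -- modulus 1, so the error is bounded by an L¹ distance that depends only on the type.
  have hest : ∀ n : ℕ, 1 ≤ n → ∀ a, |n * m n a -
      3 * h / (5 * Real.pi) * Real.exp (-(4 / 5 * (latticeNormSq a / n)))| ≤
      1 / (2 * Real.pi) ^ 2 * ∫ τ, ‖F n a.1 τ - g τ‖ := by
    intro n hn a
    have hn' : (0 : ℝ) < n := by exact_mod_cast hn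
    have h1 := natCast_mul_eq_integral (hm n).summable a hn
    have hphase : ∀ τ, 1 / √(n : ℝ) * phase τ a =
        τ.1 * (1 / √(n : ℝ) * (a.2.1 + (a.1 : ℕ) / 3)) +
          τ.2 * (1 / √(n : ℝ) * (a.2.2 + (a.1 : ℕ) / 3)) := by
      intro τ
      simp only [phase]
      ring
    have h2 := integral_exp_neg_quad_mul_exp (1 / √(n : ℝ) * (a.2.1 + (a.1 : ℕ) / 3))
      (1 / √(n : ℝ) * (a.2.2 + (a.1 : ℕ) / 3))
    simp only [← hphase] at h2
    have hQ : (1 / √(n : ℝ) * (a.2.1 + (a.1 : ℕ) / 3)) ^ 2 +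
        1 / √(n : ℝ) * (a.2.1 + (a.1 : ℕ) / 3) * (1 / √(n : ℝ) * (a.2.2 + (a.1 : ℕ) / 3)) +
        (1 / √(n : ℝ) * (a.2.2 + (a.1 : ℕ) / 3)) ^ 2 = latticeNormSq a / n := by
      have hs : 1 / √(n : ℝ) * (1 / √(n : ℝ)) = 1 / n := by
        rw [div_mul_div_comm, Real.mul_self_sqrt hn'.le, one_mul]
      unfold latticeNormSq
      linear_combination ((a.2.1 + (a.1 : ℕ) / 3 : ℝ) ^ 2 +
        (a.2.1 + (a.1 : ℕ) / 3 : ℝ) * (a.2.2 + (a.1 : ℕ) / 3) +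
        (a.2.2 + (a.1 : ℕ) / 3 : ℝ) ^ 2) * hs
    rw [hQ] at h2
    let e : ℝ × ℝ → ℂ := fun τ => Complex.exp (-(Complex.I * (1 / √n * phase τ a : ℝ)))
    have he : ∀ τ, ‖e τ‖ = 1 := fun τ => by
      simp only [e]
      rw [← mul_neg, ← Complex.ofReal_neg, Complex.norm_exp_I_mul_ofReal]
    have hem : AEStronglyMeasurable e volume := by
      simp only [e, phase]
      fun_prop
    have h3 : ∫ τ, (F n a.1 τ - g τ) * e τ = (((2 * Real.pi) ^ 2 * (n * m n a -
        3 * h / (5 * Real.pi) * Real.exp (-(4 / 5 * (latticeNormSq a / n)))) : ℝ) : ℂ) := by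
      have hgint : ∫ τ, g τ * e τ = 1 / 2 * ((24 * h * Real.pi / 5 *
          Real.exp (-(4 / 5 * (latticeNormSq a / n))) : ℝ) : ℂ) := by
        rw [← h2, ← integral_const_mul]
        congr 1
        ext τ
        simp only [g, e]
        push_cast
        ring
      simp only [sub_mul]
      rw [integral_sub ((hFi n hn a.1).mul_bdd hem (ae_of_all _ fun τ => (he τ).le))
        (hgi.mul_bdd hem (ae_of_all _ fun τ => (he τ).le)), hgint]
      have hF : ∫ τ, F n a.1 τ * e τ = (2 * Real.pi) ^ 2 * (n * m n a) := h1.symm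
      rw [hF]
      push_cast
      field_simp
      ring
    have h4 : ‖∫ τ, (F n a.1 τ - g τ) * e τ‖ ≤ ∫ τ, ‖F n a.1 τ - g τ‖ := by
      refine (norm_integral_le_integral_norm _).trans_eq ?_
      simp only [norm_mul, he, mul_one]
    rw [h3, Complex.norm_real, Real.norm_eq_abs, abs_mul, abs_of_pos (by positivity)] at h4
    rw [one_div, ← div_eq_inv_mul, le_div_iff₀ (by positivity), mul_comm]
    exact h4
  rw [Metric.tendstoUniformly_iff]
  intro ε hε
  have hε' : 0 < (2 * Real.pi) ^ 2 * ε := by positivity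
  filter_upwards [eventually_ge_atTop 1, (hlim 0).eventually (gt_mem_nhds hε'),
    (hlim 1).eventually (gt_mem_nhds hε')] with n hn hl0 hl1 a
  rw [Pi.zero_apply, dist_zero_left, Real.norm_eq_abs]
  refine (hest n hn a).trans_lt ?_
  rw [one_div, ← div_eq_inv_mul, div_lt_iff₀ (by positivity), mul_comm]
  obtain ⟨i, z⟩ := a
  fin_cases i
  · exact hl0
  · exact hl1

/-! ### From weights of tiles to densities on the plane -/

theorem tileMeasure_univ (w : Tile → ℝ≥0∞) :
    tileMeasure w Set.univ = ∑' a, w a * ENNReal.ofReal (3 * h) := by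
  simp [tileMeasure_apply w MeasurableSet.univ, volume_tileSet]

theorem isProbabilityMeasure_tileMeasure_evolve (w : Tile → ℝ≥0∞)
    [IsProbabilityMeasure (tileMeasure w)] : IsProbabilityMeasure (tileMeasure (evolve w)) := by
  rw [← map_stretch_tileMeasure]
  exact Measure.isProbabilityMeasure_map (measurable_stretch 4).aemeasurable

theorem hasSum_weights (w : Tile → ℝ≥0∞) [IsProbabilityMeasure (tileMeasure w)] :
    HasSum (fun a => 3 * h * (w a).toReal) 1 := by
  have hp := h_pos
  have h1 : ∑' a, w a * ENNReal.ofReal (3 * h) = 1 := by rw [← tileMeasure_univ, measure_univ]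
  have h2 := ENNReal.hasSum_toReal (f := fun a => w a * ENNReal.ofReal (3 * h)) (by rw [h1]; simp)
  rw [← ENNReal.tsum_toReal_eq (ENNReal.ne_top_of_tsum_ne_top (by rw [h1]; simp)), h1] at h2
  simpa [ENNReal.toReal_mul, ENNReal.toReal_ofReal, hp.le, mul_comm] using h2

theorem toReal_evolve {w : Tile → ℝ≥0∞} (hw : ∀ a, w a ≠ ∞) (a : Tile) :
    (evolve w a).toReal = evolveReal (fun a => (w a).toReal) a := by
  rw [evolve, ENNReal.toReal_mul, ENNReal.toReal_sum fun j _ => ENNReal.sum_ne_top.2 fun _ _ => hw _,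
    evolveReal]
  congr 1
  · simp
  · refine Finset.sum_congr rfl fun j _ => ?_
    rw [ENNReal.toReal_sum fun _ _ => hw _]

/-- The Gaussian density of the theorem. -/
noncomputable def gaussian (n : ℕ) (x : Plane) : ℝ :=
  1 / (5 * Real.pi * n) * Real.exp (-‖x‖ ^ 2 / (5 * n))

/-- The derivative is at most 1 in modulus, since |2x/5| ≤ 1 + x²/5 ≤ exp(x²/5). -/
theorem abs_exp_neg_sq_sub_le (u v : ℝ) :
    |Real.exp (-u ^ 2 / 5) - Real.exp (-v ^ 2 / 5)| ≤ |u - v| := by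
  have hd : ∀ x : ℝ, HasDerivAt (fun u : ℝ => Real.exp (-u ^ 2 / 5))
      (Real.exp (-x ^ 2 / 5) * (-(2 * x) / 5)) x := by
    intro x
    have := (((hasDerivAt_id x).pow 2).neg.div_const 5).exp
    simpa using this
  have := Convex.norm_image_sub_le_of_norm_hasDerivWithin_le (C := 1) (s := Set.univ)
    (fun x _ => (hd x).hasDerivWithinAt) (fun x _ => ?_) convex_univ (Set.mem_univ v) (Set.mem_univ u)
  · simpa using this
  · rw [norm_mul, Real.norm_eq_abs, Real.abs_exp, Real.norm_eq_abs, neg_div, neg_div, abs_neg,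
      Real.exp_neg, inv_mul_le_iff₀ (Real.exp_pos _), mul_one]
    refine le_trans ?_ (Real.add_one_le_exp _)
    rw [abs_le]
    constructor <;> nlinarith [sq_nonneg (x - 1), sq_nonneg (x + 1)]

/-- Phases are measured from the centre (0, h) of the tile (0, 0, 0), so the Gaussian in lattice
coordinates is centred there. -/
theorem norm_sq_tileCentre_sub (a : Tile) :
    ‖tileCentre a - !₂[0, h]‖ ^ 2 = 4 * latticeNormSq a := by
  have h3 := three_h_sq
  obtain ⟨i, k, l⟩ := a
  rw [EuclideanSpace.norm_sq_eq, Fin.sum_univ_two]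
  simp only [Real.norm_eq_abs, sq_abs, PiLp.sub_apply]
  fin_cases i
  · simp [tileCentre, latticeNormSq]
    linear_combination (3 * k ^ 2 : ℝ) * h3
  · simp [tileCentre, latticeNormSq]
    linear_combination (3 * (k + 1 / 3) ^ 2 : ℝ) * h3

/-- Passing from `x` to its centre and shifting the origin to (0, h) moves a point by at most 2 + 1,
which costs 3/√n by the Lipschitz bound at scale √n. -/
theorem abs_exp_latticeNormSq_sub_le (x : Plane) {n : ℕ} (hn : 1 ≤ n) :
    |Real.exp (-(4 / 5 * (latticeNormSq (tile x) / n))) - Real.exp (-‖x‖ ^ 2 / (5 * n))| ≤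
      3 * (1 / √n) := by
  have hn' : (0 : ℝ) < n := by exact_mod_cast hn
  set y := tileCentre (tile x) - !₂[0, h] with hy
  have hs : 0 < √(n : ℝ) := Real.sqrt_pos.2 hn'
  have := abs_exp_neg_sq_sub_le (‖y‖ / √n) (‖x‖ / √n)
  rw [div_pow, div_pow, Real.sq_sqrt hn'.le, norm_sq_tileCentre_sub] at this
  have e1 : -(4 / 5 * (latticeNormSq (tile x) / n)) = -(4 * latticeNormSq (tile x) / n) / 5 := by ring
  have e2 : -‖x‖ ^ 2 / (5 * n) = -(‖x‖ ^ 2 / n) / 5 := by ring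
  rw [e1, e2]
  refine this.trans ?_
  rw [← sub_div, abs_div, abs_of_pos hs, mul_one_div]
  refine div_le_div_of_nonneg_right ?_ hs.le
  refine (abs_norm_sub_norm_le _ _).trans ?_
  have h1 : y - x = -(x - centre x) - !₂[0, h] := by
    rw [hy, centre_eq_tileCentre]; abel
  have h2 : ‖(!₂[0, h] : Plane)‖ ≤ 1 := by
    refine le_of_sq_le_sq ?_ zero_le_one
    rw [EuclideanSpace.norm_sq_eq, Fin.sum_univ_two]
    simp
    rw [← sq_le_one_iff_abs_le_one]
    nlinarith [three_h_sq]
  rw [h1]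
  refine (norm_sub_le _ _).trans ?_
  rw [norm_neg]
  linarith [norm_sub_centre_le x]

theorem tendstoUniformly_density {m : ℕ → Tile → ℝ} (hm0 : ∀ n a, 0 ≤ m n a)
    (hm : ∀ n, HasSum (m n) 1) (hrec : ∀ n, m (n + 1) = evolveReal (m n)) :
    TendstoUniformly (fun (n : ℕ) x => (n : ℝ) * (m n (tile x) / (3 * h) - gaussian n x)) 0 atTop := by
  have hp := h_pos
  have hpi := Real.pi_pos
  have hU := Metric.tendstoUniformly_iff.1 (tendstoUniformly_weights hm0 hm hrec)
  rw [Metric.tendstoUniformly_iff]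
  intro ε hε
  have hlim : Tendsto (fun n : ℕ => 1 / (5 * Real.pi) * (3 * (1 / √(n : ℝ)))) atTop (𝓝 0) := by
    simpa using (tendsto_one_div_sqrt.const_mul 3).const_mul (1 / (5 * Real.pi))
  filter_upwards [hU (3 * h * (ε / 2)) (by positivity), eventually_ge_atTop 1,
    hlim.eventually (gt_mem_nhds (half_pos hε))] with n h1 hn h2 x
  have hn' : (0 : ℝ) < n := by exact_mod_cast hn
  have k1 := h1 (tile x)
  rw [Pi.zero_apply, dist_zero_left, Real.norm_eq_abs] at k1 ⊢
  have k2 := mul_le_mul_of_nonneg_left (abs_exp_latticeNormSq_sub_le x hn)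
    (show 0 ≤ 1 / (5 * Real.pi) by positivity)
  rw [mul_comm (3 * h) (ε / 2), ← div_lt_iff₀ (by positivity)] at k1
  have e : (n : ℝ) * (m n (tile x) / (3 * h) - gaussian n x) =
      (n * m n (tile x) - 3 * h / (5 * Real.pi) *
        Real.exp (-(4 / 5 * (latticeNormSq (tile x) / n)))) / (3 * h) +
      1 / (5 * Real.pi) * (Real.exp (-(4 / 5 * (latticeNormSq (tile x) / n))) -
        Real.exp (-‖x‖ ^ 2 / (5 * n))) := by
    unfold gaussian
    field_simp
    ring
  rw [e]
  refine (abs_add_le _ _).trans_lt ?_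
  rw [abs_div, abs_of_pos (by positivity : 0 < 3 * h), abs_mul (1 / (5 * Real.pi)),
    abs_of_pos (by positivity : 0 < 1 / (5 * Real.pi))]
  linarith

/-! ### From uniform convergence to convergence in L¹ -/

theorem integrable_gaussian {n : ℕ} (hn : 1 ≤ n) : Integrable (gaussian n) := by
  have hn' : (0 : ℝ) < n := by exact_mod_cast hn
  have := GaussianFourier.integrable_cexp_neg_mul_sq_norm_add (V := Plane)
    (b := ((1 / (5 * n) : ℝ) : ℂ)) (by rw [Complex.ofReal_re]; positivity) 0 0
  refine (this.re.const_mul (1 / (5 * Real.pi * n))).congr (ae_of_all _ fun x => ?_)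
  simp only [gaussian]
  congr 1
  have : -((1 / (5 * n) : ℝ) : ℂ) * (‖x‖ : ℂ) ^ 2 + 0 * (inner ℝ (0 : Plane) x : ℝ) =
      ((-‖x‖ ^ 2 / (5 * n) : ℝ) : ℂ) := by
    push_cast
    ring
  rw [this, ← Complex.ofReal_exp]
  exact Complex.ofReal_re _

theorem integral_gaussian_eq_one {n : ℕ} (hn : 1 ≤ n) : ∫ x, gaussian n x = 1 := by
  have hn' : (0 : ℝ) < n := by exact_mod_cast hn
  have hpi := Real.pi_pos
  have := GaussianFourier.integral_rexp_neg_mul_sq_norm (V := Plane) (b := 1 / (5 * (n : ℝ)))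
    (by positivity)
  simp only [gaussian]
  rw [integral_const_mul]
  have e : ∀ x : Plane, -‖x‖ ^ 2 / (5 * n) = -(1 / (5 * (n : ℝ))) * ‖x‖ ^ 2 := fun x => by ring
  simp only [e, this]
  simp
  field_simp

theorem natCast_mul_gaussian {n : ℕ} (hn : 1 ≤ n) (y : Plane) :
    n * gaussian n (√n • y) = gaussian 1 y := by
  have hn' : (0 : ℝ) < n := by exact_mod_cast hn
  unfold gaussian
  rw [norm_smul, mul_pow, Real.norm_eq_abs, sq_abs, Real.sq_sqrt hn'.le]
  have : -(n * ‖y‖ ^ 2) / (5 * n) = -‖y‖ ^ 2 / (5 * (1 : ℕ)) := by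
    push_cast
    field_simp
  rw [this]
  push_cast
  field_simp

theorem gaussian_nonneg (n : ℕ) (x : Plane) : 0 ≤ gaussian n x := by
  unfold gaussian
  positivity

/-- For probability densities, uniform convergence at the scale of the Gaussian implies convergence
in the mean. -/
theorem tendsto_lintegral_of_tendstoUniformly {ρ : ℕ → Plane → ℝ} (hρ0 : ∀ n x, 0 ≤ ρ n x)
    (hρi : ∀ n, Integrable (ρ n)) (hρ1 : ∀ n, ∫ x, ρ n x = 1)
    (hU : TendstoUniformly (fun (n : ℕ) x => (n : ℝ) * (ρ n x - gaussian n x)) 0 atTop) :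
    Tendsto (fun n => ∫⁻ x, ENNReal.ofReal |ρ n x - gaussian n x|) atTop (𝓝 0) := by
  -- Only the positive part of Gaussian minus density is needed: since ρ ≥ 0, its rescaling is
  -- dominated by the fixed function `gaussian 1`.
  have hmax : Tendsto (fun n : ℕ => ∫ y : Plane, max (n * (gaussian n (√n • y) - ρ n (√n • y))) 0)
      atTop (𝓝 0) := by
    have := tendsto_integral_filter_of_dominated_convergence (μ := volume) (l := atTop)
      (F := fun (n : ℕ) (y : Plane) => max (n * (gaussian n (√n • y) - ρ n (√n • y))) 0)
      (f := fun _ => (0 : ℝ)) (gaussian 1) ?_ ?_ (integrable_gaussian le_rfl) ?_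
    · simpa using this
    · filter_upwards [eventually_ge_atTop 1] with n hn
      have hn' : (0 : ℝ) < n := by exact_mod_cast hn
      have hs : √(n : ℝ) ≠ 0 := (Real.sqrt_pos.2 hn').ne'
      have := (((integrable_gaussian hn).sub (hρi n)).comp_smul hs).const_mul (n : ℝ)
      exact this.aestronglyMeasurable.sup aestronglyMeasurable_const
    · filter_upwards [eventually_ge_atTop 1] with n hn
      refine ae_of_all _ fun y => ?_
      rw [Real.norm_eq_abs, abs_of_nonneg (le_max_right _ _), ← natCast_mul_gaussian hn]
      have := mul_nonneg (Nat.cast_nonneg (α := ℝ) n) (hρ0 n (√n • y))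
      have := mul_nonneg (Nat.cast_nonneg (α := ℝ) n) (gaussian_nonneg n (√n • y))
      refine max_le ?_ this
      rw [mul_sub]
      linarith
    · refine ae_of_all _ fun y => ?_
      rw [Metric.tendsto_nhds]
      intro ε hε
      filter_upwards [Metric.tendstoUniformly_iff.1 hU ε hε] with n hn
      have := hn (√n • y)
      rw [Pi.zero_apply, dist_zero_left, Real.norm_eq_abs, abs_lt] at this
      rw [dist_zero_right, Real.norm_eq_abs, abs_of_nonneg (le_max_right _ _)]
      refine max_lt ?_ hε
      linarith [this.1]
  have hval : ∀ n : ℕ, 1 ≤ n → ∫⁻ x, ENNReal.ofReal |ρ n x - gaussian n x| =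
      ENNReal.ofReal (2 * ∫ y : Plane, max (n * (gaussian n (√n • y) - ρ n (√n • y))) 0) := by
    intro n hn
    have hn' : (0 : ℝ) < n := by exact_mod_cast hn
    have hd : Integrable fun x => ρ n x - gaussian n x := (hρi n).sub (integrable_gaussian hn)
    have hp : Integrable fun x => max (gaussian n x - ρ n x) 0 :=
      ((integrable_gaussian hn).sub (hρi n)).pos_part
    have hscale : ∫ y : Plane, max (n * (gaussian n (√n • y) - ρ n (√n • y))) 0 =
        ∫ x, max (gaussian n x - ρ n x) 0 := by
      have key := Measure.integral_comp_smul (volume : Measure Plane)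
        (fun x => max (gaussian n x - ρ n x) 0) (√n)
      have e2 : |(√(n : ℝ) ^ Module.finrank ℝ Plane)⁻¹| = (n : ℝ)⁻¹ := by
        rw [finrank_euclideanSpace, Fintype.card_fin, Real.sq_sqrt hn'.le]
        exact abs_of_pos (by positivity)
      rw [e2, smul_eq_mul] at key
      have e3 : ∀ y : Plane, max (n * (gaussian n (√n • y) - ρ n (√n • y))) 0 =
          n * max (gaussian n (√n • y) - ρ n (√n • y)) 0 := fun y => by
        rw [mul_max_of_nonneg _ _ hn'.le, mul_zero]
      simp only [e3, integral_const_mul, key]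
      field_simp
    rw [hscale, ← ofReal_integral_eq_lintegral_ofReal hd.abs (ae_of_all _ fun x => abs_nonneg _)]
    congr 1
    -- Since both densities have integral 1, the first summand integrates to zero and the L¹
    -- distance is twice the integral of the positive part.
    have e : ∀ x, |ρ n x - gaussian n x| =
        (ρ n x - gaussian n x) + 2 * max (gaussian n x - ρ n x) 0 := by
      intro x
      rcases le_total (ρ n x) (gaussian n x) with q | q
      · rw [abs_of_nonpos (by linarith), max_eq_left (by linarith)]; ring
      · rw [abs_of_nonneg (by linarith), max_eq_right (by linarith)]; ring
    simp only [e]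
    rw [integral_add hd (hp.const_mul 2), integral_const_mul, integral_sub (hρi n) (integrable_gaussian hn), hρ1, integral_gaussian_eq_one hn]
    ring
  have := (ENNReal.continuous_ofReal.tendsto _).comp (hmax.const_mul 2)
  rw [mul_zero, ENNReal.ofReal_zero] at this
  refine this.congr' ?_
  filter_upwards [eventually_ge_atTop 1] with n hn
  exact (hval n hn).symm

theorem HasTriangleDensity.measurable {μ : Measure Plane} {ρ : Plane → ℝ}
    (hρ : HasTriangleDensity μ ρ) : Measurable ρ := by
  have : ρ = (fun a => ρ (tileCentre a)) ∘ tile := funext hρ.eq_apply_tile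
  rw [this]
  exact measurable_from_top.comp measurable_tile

theorem HasTriangleDensity.lintegral_eq_one {μ : Measure Plane} [IsProbabilityMeasure μ]
    {ρ : Plane → ℝ} (hρ : HasTriangleDensity μ ρ) : ∫⁻ x, ENNReal.ofReal (ρ x) = 1 := by
  have := measure_univ (μ := μ)
  rwa [hρ.eq_withDensity, withDensity_apply _ MeasurableSet.univ, Measure.restrict_univ] at this

theorem HasTriangleDensity.integrable {μ : Measure Plane} [IsProbabilityMeasure μ]
    {ρ : Plane → ℝ} (hρ : HasTriangleDensity μ ρ) : Integrable ρ := by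
  refine ⟨hρ.measurable.aestronglyMeasurable, ?_⟩
  rw [hasFiniteIntegral_iff_ofReal (ae_of_all _ hρ.nonneg), hρ.lintegral_eq_one]
  exact ENNReal.one_lt_top

theorem HasTriangleDensity.integral_eq_one {μ : Measure Plane} [IsProbabilityMeasure μ]
    {ρ : Plane → ℝ} (hρ : HasTriangleDensity μ ρ) : ∫ x, ρ x = 1 := by
  rw [integral_eq_lintegral_of_nonneg_ae (ae_of_all _ hρ.nonneg)
    hρ.measurable.aestronglyMeasurable, hρ.lintegral_eq_one, ENNReal.toReal_one]

end TriangleTiling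

/-! ### Assembly of the theorem -/

open TriangleTiling
theorem mainTheorem1 (μ₀ : Measure Plane) [IsProbabilityMeasure μ₀] (ρ₀ : Plane → ℝ)
    (hρ₀ : HasTriangleDensity μ₀ ρ₀) :
    ∃ ρ : ℕ → Plane → ℝ, ρ 0 = ρ₀ ∧
      (∀ n : ℕ, HasTriangleDensity ((perronFrobenius (stretch 4))^[n] μ₀) (ρ n)) ∧
      (∀ (n : ℕ) (i : Fin 2),
        atCentres ((perronFrobenius (stretch 4))^[n + 1] μ₀) i =
          ∑ j, E i j ∗ atCentres ((perronFrobenius (stretch 4))^[n] μ₀) j) ∧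
      TendstoUniformly
        (fun (n : ℕ) (x : Plane) =>
          (n : ℝ) * (ρ n x - 1 / (5 * Real.pi * n) * Real.exp (-‖x‖ ^ 2 / (5 * n))))
        0 atTop ∧
      Tendsto
        (fun n : ℕ => ∫⁻ x : Plane, ENNReal.ofReal
          |ρ n x - 1 / (5 * Real.pi * n) * Real.exp (-‖x‖ ^ 2 / (5 * n))|)
        atTop (𝓝 0) ∧
      Tendsto
        (fun n : ℕ => (∫ x, ‖(stretch 4)^[n] x - x‖ ^ 2 ∂μ₀) / (4 * n))
        atTop (𝓝 (5 / 4)) := by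
  have hp := h_pos
  let w : Tile → ℝ≥0∞ := fun a => ENNReal.ofReal (ρ₀ (tileCentre a))
  have hw : μ₀ = tileMeasure w := hρ₀.eq_tileMeasure
  have hprob : IsProbabilityMeasure (tileMeasure w) := hw ▸ inferInstance
  have htop : ∀ n a, (evolve^[n] w) a ≠ ∞ := by
    intro n
    induction n with
    | zero => exact fun a => ENNReal.ofReal_ne_top
    | succ n ih =>
      rw [Function.iterate_succ_apply']
      exact evolve_ne_top ih
  have hpn : ∀ n, IsProbabilityMeasure (tileMeasure (evolve^[n] w)) := by
    intro n
    induction n with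
    | zero => exact hprob
    | succ n ih =>
      rw [Function.iterate_succ_apply']
      exact isProbabilityMeasure_tileMeasure_evolve _
  -- The mass of a tile is its density times the common area 3h; equality of the areas makes masses
  -- and densities obey the same recursion.
  let m : ℕ → Tile → ℝ := fun n a => 3 * h * ((evolve^[n] w) a).toReal
  have hm0 : ∀ n a, 0 ≤ m n a := fun n a => mul_nonneg (by positivity) ENNReal.toReal_nonneg
  have hm : ∀ n, HasSum (m n) 1 := fun n => hasSum_weights _
  have hrec : ∀ n, m (n + 1) = evolveReal (m n) := by
    intro n
    ext a
    simp only [m, Function.iterate_succ_apply']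
    rw [toReal_evolve (htop n)]
    simp only [evolveReal, Finset.mul_sum]
    refine Finset.sum_congr rfl fun j _ => Finset.sum_congr rfl fun d _ => ?_
    ring
  let ρ : ℕ → Plane → ℝ := fun n x => ((evolve^[n] w) (tile x)).toReal
  have hρ : ∀ n, HasTriangleDensity (tileMeasure (evolve^[n] w)) (ρ n) := fun n =>
    hasTriangleDensity_tileMeasure (htop n)
  have hU : TendstoUniformly (fun (n : ℕ) x => (n : ℝ) * (ρ n x - gaussian n x)) 0 atTop := by
    have := tendstoUniformly_density hm0 hm hrec
    have e : ∀ n x, m n (tile x) / (3 * h) = ρ n x := fun n x => by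
      simp only [m, ρ]
      field_simp
    simpa only [e] using this
  rw [hw]
  simp only [perronFrobenius_iterate_tileMeasure]
  refine ⟨ρ, ?_, hρ, fun n i => ?_, hU, ?_, tendsto_mean_norm_sq_iterate_sub w⟩
  · ext x
    simp only [ρ, Function.iterate_zero, id, w]
    rw [ENNReal.toReal_ofReal (hρ₀.nonneg _), ← hρ₀.eq_apply_tile]
  · rw [Function.iterate_succ_apply']
    refine atCentres_evolve _ i fun j => ?_
    unfold atCentres
    infer_instance
  · exact tendsto_lintegral_of_tendstoUniformly (fun n => (hρ n).nonneg)
      (fun n => (hρ n).integrable) (fun n => (hρ n).integral_eq_one) hU
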